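/- **Truth Lemma.** Fix a countably infinite set $\mathsf P$ of propositional variables. The formulas of the continuous modal $\mu$-calculus $\mu_c\mathsf{ML}$ are given by $$\varphi ::= p \mid \neg p \mid \varphi\lor\varphi \mid \varphi\land\varphi \mid \Diamond\varphi \mid \Box\varphi \mid \mu x.\varphi' \mid \nu x.\varphi''$$ with $\varphi'\in\mathsf{Con}_{\{x\}}$ and $\varphi''\in\mathsf{Cocon}_{\{x\}}$, where, by simultaneous induction, for $X\subseteq\mathsf P$ the fragment $\mathsf{Con}_X$ is generated by $x\mid\alpha\mid\varphi\lor\varphi\mid\varphi\land\varphi\mid\Diamond\varphi\mid\mu y.\varphi'$ and $\mathsf{Cocon}_X$ by $x\mid\alpha\mid\varphi\lor\varphi\mid\varphi\land\varphi\mid\Box\varphi\mid\nu y.\varphi'$, with $x\in X$, $y \in \mathsf P$, $\alpha$ a $\mu_c\mathsf{ML}$-formula in which no variable of $X$ is free, and $\varphi'$ in $\mathsf{Con}_{X\cup\{y\}}$, respectively $\mathsf{Cocon}_{X\cup\{y\}}$. Negation ${\sim}\varphi$ is defined by dualising all connectives, with ${\sim}\mu x.\varphi=\nu x.({\sim}\varphi)[\neg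 x/x]$ and ${\sim}\nu x.\varphi=\mu x.({\sim}\varphi)[\neg x/x]$; $\varphi\to\psi$ is ${\sim}\varphi\lor\psi$; $\bot$ and $\top$ abbreviate $p_0\land\neg p_0$ and $p_0\lor\neg p_0$ for a fixed variable $p_0$; $\varphi[\psi/x]$ is capture-avoiding substitution. Formulas are interpreted in Kripke models $(S,R,V)$ as usual: $\mu x.\varphi$ denotes $\bigcap\{X\subseteq S: [\![\varphi]\!]^{V[x\mapsto X]}\subseteq X\}$ and $\nu x.\varphi$ denotes $\bigcup\{X\subseteq S: X\subseteq[\![\varphi]\!]^{V[x\mapsto X]}\}$. A formula $\xi$ is *clean* if no variable occurs in it both free and bound and, for each bound variable $x$, there are a unique binder $\eta$ and a unique formula $\delta$ such that $\eta x.\delta$ is a subformula of $\xi$. A *$\mu_c$-logic* is a set $\mathsf L$ of $\mu_c\mathsf{ML}$-formulas that contains all classical tautologies, ${\sim}\Diamond\bot$, $\Diamond(p\lor q)\leftrightarrow(\Diamond p\lor\Diamond q)$ for variables $p,q$, and $\varphi[\mu x.\varphi/x]\to\mu x.\varphi$ for all $\varphi\in\mathsf{Con}_{\{x\}}$, and that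 is closed under modus ponens, monotonicity (from $\varphi\to\psi$ derive $\Diamond\varphi\to\Diamond\psi$), uniform substitution (from $\varphi$ derive $\varphi[\psi/x]$) and the least prefixpoint rule (from $\varphi[\gamma/x]\to\gamma$ with $\varphi\in\mathsf{Con}_{\{x\}}$ derive $\mu x.\varphi\to\gamma$). A set $\Gamma$ of formulas is *$\mathsf L$-inconsistent* if $(\gamma_1\land\dots\land\gamma_n)\to\bot\in\mathsf L$ for some $\gamma_1,\dots,\gamma_n\in\Gamma$, and *maximally $\mathsf L$-consistent* if it is $\mathsf L$-consistent and every set of formulas properly extending it is $\mathsf L$-inconsistent; a formula $\varphi$ is $\mathsf L$-consistent if $\{\varphi\}$ is. A set $\Sigma$ of formulas is *${\sim}$FL-closed* if $\varphi\in\Sigma$ implies ${\sim}\varphi\in\Sigma$, and moreover: $\neg p\in\Sigma$ implies $p\in\Sigma$; $\varphi\lor\psi\in\Sigma$ or $\varphi\land\psi\in\Sigma$ implies $\varphi,\psi\in\Sigma$; $\Diamond\varphi\in\Sigma$ or $\Box\varphi\in\Sigma$ implies $\varphi\in\Sigma$; and $\eta x.\varphi\in\Sigma$ (with $\eta\in\{\mu,\nu\}$)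 implies $\varphi[\eta x.\varphi/x]\in\Sigma$. For a finite ${\sim}$FL-closed set $\Sigma$ of $\mu_c\mathsf{ML}$-formulas, a *model over $\Sigma$ with respect to $\mathsf L$* is a Kripke model $(S,R,V)$ such that $S=\{\Gamma\cap\Sigma:\Gamma\text{ maximally }\mathsf L\text{-consistent}\}$; for all $A,B\in S$, if $\bigwedge A\land\Diamond\bigwedge B$ is $\mathsf L$-consistent then $ARB$, and if $ARB$ then for all $\Box\varphi\in\Sigma$, $\Box\varphi\in A$ implies $\varphi\in B$; and $V(p)=\{A\in S:p\in A\}$ for every variable $p\in\Sigma$. Let $\mathsf L$ be a $\mu_c$-logic, $\Sigma$ a finite ${\sim}$FL-closed set of $\mu_c\mathsf{ML}$-formulas and $\mathbb S=(S,R,V)$ a model over $\Sigma$ with respect to $\mathsf L$. If $A\in S$ and $\xi\in\Sigma$ is clean, then $$\xi\in A\ \Longrightarrow\ A\in[\![\xi]\!]^{\mathbb S}.$$ -/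

import Mathlib

namespace MuC

/-- The two fixpoint binders `μ` and `ν`. -/
inductive Binder : Type
  | mu : Binder
  | nu : Binder

/-- The dual binder. -/
def Binder.dual : Binder → Binder
  | Binder.mu => Binder.nu
  | Binder.nu => Binder.mu

/-- Raw fixpoint formulas in negation normal form, over the countably infinite set `ℕ` of
propositional variables. The language of the continuous modal `μ`-calculus is carved out by
`IsFormula` below. -/
inductive Fml : Type
  | var : ℕ → Fml
  | nvar : ℕ → Fml
  | or : Fml → Fml → Fml
  | and : Fml → Fml → Fml
  | dia : Fml → Fml
  | box : Fml → Fml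
  | fix : Binder → ℕ → Fml → Fml

namespace Fml

/-- `μ x. φ` -/
abbrev mu (x : ℕ) (φ : Fml) : Fml := fix Binder.mu x φ

/-- `ν x. φ` -/
abbrev nu (x : ℕ) (φ : Fml) : Fml := fix Binder.nu x φ

/-- The set of free variables. -/
def FV : Fml → Finset ℕ
  | var p => {p}
  | nvar p => {p}
  | or φ ψ => FV φ ∪ FV ψ
  | and φ ψ => FV φ ∪ FV ψ
  | dia φ => FV φ
  | box φ => FV φ
  | fix _ x φ => (FV φ).erase x

/-- The set of bound variables. -/
def BV : Fml → Finset ℕ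
  | var _ => ∅
  | nvar _ => ∅
  | or φ ψ => BV φ ∪ BV ψ
  | and φ ψ => BV φ ∪ BV ψ
  | dia φ => BV φ
  | box φ => BV φ
  | fix _ x φ => insert x (BV φ)

/-- The set of subformulas. -/
def Sf : Fml → Set Fml
  | var p => {var p}
  | nvar p => {nvar p, var p}
  | or φ ψ => {or φ ψ} ∪ (Sf φ ∪ Sf ψ)
  | and φ ψ => {and φ ψ} ∪ (Sf φ ∪ Sf ψ)
  | dia φ => {dia φ} ∪ Sf φ
  | box φ => {box φ} ∪ Sf φ
  | fix η x φ => {fix η x φ} ∪ Sf φ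

/-- `φ.negVar x` is `φ[¬x/x]`: every free literal `x` is replaced by `¬x`, and every free literal
`¬x` by `¬¬x`, that is, by `x`. -/
def negVar (x : ℕ) : Fml → Fml
  | var p => if p = x then nvar p else var p
  | nvar p => if p = x then var p else nvar p
  | or φ ψ => or (negVar x φ) (negVar x ψ)
  | and φ ψ => and (negVar x φ) (negVar x ψ)
  | dia φ => dia (negVar x φ)
  | box φ => box (negVar x φ)
  | fix η y φ => if y = x then fix η y φ else fix η y (negVar x φ)

/-- The negation `∼φ`; in particular `∼ηx.φ` is the dual binder applied to `(∼φ)[¬x/x]`. -/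
def neg : Fml → Fml
  | var p => nvar p
  | nvar p => var p
  | or φ ψ => and (neg φ) (neg ψ)
  | and φ ψ => or (neg φ) (neg ψ)
  | dia φ => box (neg φ)
  | box φ => dia (neg φ)
  | fix η x φ => fix η.dual x (negVar x (neg φ))

/-- Simultaneous capture-avoiding substitution. A binder `y` is renamed (to a fresh variable)
exactly when it would capture a free variable of a substituted formula. -/
def subst : (ℕ → Fml) → Fml → Fml
  | σ, var p => σ p
  | σ, nvar p => neg (σ p)
  | σ, or φ ψ => or (subst σ φ) (subst σ ψ)
  | σ, and φ ψ => and (subst σ φ) (subst σ ψ)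
  | σ, dia φ => dia (subst σ φ)
  | σ, box φ => box (subst σ φ)
  | σ, fix η y φ =>
      let avoid : Finset ℕ := ((FV φ).erase y).biUnion (fun p => FV (σ p))
      let z : ℕ := if y ∈ avoid then avoid.sup id + 1 else y
      fix η z (subst (Function.update σ y (var z)) φ)

/-- `φ.subst1 x ψ` is `φ[ψ/x]`. -/
def subst1 (φ : Fml) (x : ℕ) (ψ : Fml) : Fml :=
  subst (Function.update var x ψ) φ

/-- Falsum, as a propositional abbreviation. -/
def bot : Fml := and (var 0) (nvar 0)

/-- Verum, as a propositional abbreviation. -/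
def top : Fml := or (var 0) (nvar 0)

/-- Material implication. -/
def imp (φ ψ : Fml) : Fml := or (neg φ) ψ

/-- Material equivalence. -/
def iff (φ ψ : Fml) : Fml := and (imp φ ψ) (imp ψ φ)

/-- Conjunction of a list of formulas. -/
def conjList : List Fml → Fml
  | [] => top
  | φ :: l => and φ (conjList l)

/-- `⋀ A` for a finite set `A` of formulas (in some order). -/
noncomputable def conj (A : Finset Fml) : Fml := conjList A.toList

/-- A formula is tidy if no variable occurs in it both free and bound. -/
def Tidy (φ : Fml) : Prop := Disjoint (FV φ) (BV φ)

/-- A formula is clean if it is tidy and every bound variable `x` determines a unique binder `η`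
and a unique formula `δ` such that `ηx.δ` is a subformula. -/
def Clean (φ : Fml) : Prop :=
  Tidy φ ∧ ∀ x ∈ BV φ, ∃! d : Binder × Fml, fix d.1 x d.2 ∈ Sf φ

end Fml

open Fml

mutual

/-- The formulas of the continuous modal `μ`-calculus. -/
inductive IsFormula : Fml → Prop
  | var (p : ℕ) : IsFormula (var p)
  | nvar (p : ℕ) : IsFormula (nvar p)
  | or {φ ψ : Fml} : IsFormula φ → IsFormula ψ → IsFormula (or φ ψ)
  | and {φ ψ : Fml} : IsFormula φ → IsFormula ψ → IsFormula (and φ ψ)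
  | dia {φ : Fml} : IsFormula φ → IsFormula (dia φ)
  | box {φ : Fml} : IsFormula φ → IsFormula (box φ)
  | mu {x : ℕ} {φ : Fml} : Con {x} φ → IsFormula (mu x φ)
  | nu {x : ℕ} {φ : Fml} : Cocon {x} φ → IsFormula (nu x φ)

/-- The formulas that are continuous in `X`. -/
inductive Con : Set ℕ → Fml → Prop
  | var {X : Set ℕ} {x : ℕ} : x ∈ X → Con X (var x)
  | free {X : Set ℕ} {α : Fml} : IsFormula α → (∀ x ∈ X, x ∉ FV α) → Con X α
  | or {X : Set ℕ} {φ ψ : Fml} : Con X φ → Con X ψ → Con X (or φ ψ)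
  | and {X : Set ℕ} {φ ψ : Fml} : Con X φ → Con X ψ → Con X (and φ ψ)
  | dia {X : Set ℕ} {φ : Fml} : Con X φ → Con X (dia φ)
  | mu {X : Set ℕ} {y : ℕ} {φ : Fml} : Con (X ∪ {y}) φ → Con X (mu y φ)

/-- The formulas that are cocontinuous in `X`. -/
inductive Cocon : Set ℕ → Fml → Prop
  | var {X : Set ℕ} {x : ℕ} : x ∈ X → Cocon X (var x)
  | free {X : Set ℕ} {α : Fml} : IsFormula α → (∀ x ∈ X, x ∉ FV α) → Cocon X α
  | or {X : Set ℕ} {φ ψ : Fml} : Cocon X φ → Cocon X ψ → Cocon X (or φ ψ)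
  | and {X : Set ℕ} {φ ψ : Fml} : Cocon X φ → Cocon X ψ → Cocon X (and φ ψ)
  | box {X : Set ℕ} {φ : Fml} : Cocon X φ → Cocon X (box φ)
  | nu {X : Set ℕ} {y : ℕ} {φ : Fml} : Cocon (X ∪ {y}) φ → Cocon X (nu y φ)

end

/-- The language of the continuous modal `μ`-calculus. -/
def Language : Set Fml := {φ | IsFormula φ}

/-- The FL-closure of a set of formulas. -/
inductive FLClosure (Φ : Set Fml) : Fml → Prop
  | base {φ : Fml} : φ ∈ Φ → FLClosure Φ φ
  | nvar {p : ℕ} : FLClosure Φ (nvar p) → FLClosure Φ (var p)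
  | or_left {φ ψ : Fml} : FLClosure Φ (or φ ψ) → FLClosure Φ φ
  | or_right {φ ψ : Fml} : FLClosure Φ (or φ ψ) → FLClosure Φ ψ
  | and_left {φ ψ : Fml} : FLClosure Φ (and φ ψ) → FLClosure Φ φ
  | and_right {φ ψ : Fml} : FLClosure Φ (and φ ψ) → FLClosure Φ ψ
  | dia {φ : Fml} : FLClosure Φ (dia φ) → FLClosure Φ φ
  | box {φ : Fml} : FLClosure Φ (box φ) → FLClosure Φ φ
  | unfold {η : Binder} {x : ℕ} {φ : Fml} :
      FLClosure Φ (fix η x φ) → FLClosure Φ (φ.subst1 x (fix η x φ))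

/-- `Φ` is FL-closed if it equals its own FL-closure. -/
def FLClosed (Φ : Set Fml) : Prop := {φ | FLClosure Φ φ} = Φ

/-- `Φ` is closed under negation. -/
def NegClosed (Φ : Set Fml) : Prop := ∀ φ ∈ Φ, neg φ ∈ Φ

/-- Kripke models on a set `S` of states. -/
structure Model (S : Type*) where
  /-- the accessibility relation -/
  R : S → S → Prop
  /-- the valuation -/
  V : ℕ → Set S

/-- `M[x ↦ X]` -/
def Model.update {S : Type*} (M : Model S) (x : ℕ) (X : Set S) : Model S where
  R := M.R
  V := Function.update M.V x X

/-- The meaning of a formula in a model. -/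
def meaning {S : Type*} : Fml → Model S → Set S
  | .var p, M => M.V p
  | .nvar p, M => (M.V p)ᶜ
  | .or φ ψ, M => meaning φ M ∪ meaning ψ M
  | .and φ ψ, M => meaning φ M ∩ meaning ψ M
  | .dia φ, M => {s | ∃ t, M.R s t ∧ t ∈ meaning φ M}
  | .box φ, M => {s | ∀ t, M.R s t → t ∈ meaning φ M}
  | .fix .mu x φ, M => ⋂₀ {X | meaning φ (M.update x X) ⊆ X}
  | .fix .nu x φ, M => ⋃₀ {X | X ⊆ meaning φ (M.update x X)}

/-- Classical tautologies: formulas true under every two-valued assignment to formulas that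
respects the Boolean connectives `∼`, `∨`, `∧` (and is otherwise arbitrary, in particular on
modal and fixpoint formulas). -/
def Tautology (φ : Fml) : Prop :=
  ∀ v : Fml → Prop,
    (∀ α, v (neg α) ↔ ¬ v α) →
    (∀ α β, v (or α β) ↔ v α ∨ v β) →
    (∀ α β, v (and α β) ↔ v α ∧ v β) →
    v φ

/-- `μ_c`-logics: sets of formulas that contain the axioms of `μ_c K` and are closed under its
rules. The dual versions of the axioms and rules are instances of these, since `→` is defined
from the negation `∼`. -/
structure IsMucLogic (L : Set Fml) : Prop where
  subset_language : L ⊆ Language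
  tautology : ∀ φ, IsFormula φ → Tautology φ → φ ∈ L
  normality : neg (dia bot) ∈ L
  additivity : ∀ p q : ℕ,
    iff (dia (or (var p) (var q))) (or (dia (var p)) (dia (var q))) ∈ L
  prefixpoint : ∀ (x : ℕ) (φ : Fml), Con {x} φ → imp (φ.subst1 x (mu x φ)) (mu x φ) ∈ L
  modus_ponens : ∀ φ ψ, imp φ ψ ∈ L → φ ∈ L → ψ ∈ L
  monotonicity : ∀ φ ψ, imp φ ψ ∈ L → imp (dia φ) (dia ψ) ∈ L
  substitution : ∀ (φ : Fml) (x : ℕ) (ψ : Fml), φ ∈ L → IsFormula ψ → φ.subst1 x ψ ∈ L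
  least_prefixpoint : ∀ (x : ℕ) (φ γ : Fml), Con {x} φ → IsFormula γ →
    imp (φ.subst1 x γ) γ ∈ L → imp (mu x φ) γ ∈ L

/-- A set of formulas is `L`-inconsistent if `L` proves `γ₁ ∧ ⋯ ∧ γₙ → ⊥` for some members
`γ₁, …, γₙ` of it. -/
def Inconsistent (L Γ : Set Fml) : Prop :=
  ∃ l : List Fml, (∀ γ ∈ l, γ ∈ Γ) ∧ imp (conjList l) bot ∈ L

/-- `L`-consistency of a set of formulas. -/
def Consistent (L Γ : Set Fml) : Prop := ¬ Inconsistent L Γ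

/-- Maximally `L`-consistent sets of formulas. -/
structure MaxConsistent (L Γ : Set Fml) : Prop where
  subset_language : Γ ⊆ Language
  consistent : Consistent L Γ
  maximal : ∀ Γ' : Set Fml, Γ' ⊆ Language → Γ ⊂ Γ' → Inconsistent L Γ'

/-- The states of a model over `Sig`: the sets `Γ ∩ Sig` with `Γ` maximally `L`-consistent. -/
def State (L : Set Fml) (Sig : Finset Fml) : Type :=
  {A : Finset Fml // ∃ Γ : Set Fml, MaxConsistent L Γ ∧ (A : Set Fml) = Γ ∩ (Sig : Set Fml)}

/-- The finest relation. -/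
def Rmin (L : Set Fml) (Sig : Finset Fml) (A B : State L Sig) : Prop :=
  Consistent L {and (conj A.1) (dia (conj B.1))}

/-- The coarsest relation. -/
def Rmax (L : Set Fml) (Sig : Finset Fml) (A B : State L Sig) : Prop :=
  ∀ φ : Fml, box φ ∈ Sig → box φ ∈ A.1 → φ ∈ B.1

/-- Models over `Sig` with respect to `L`. -/
structure IsModelOver (L : Set Fml) (Sig : Finset Fml) (M : Model (State L Sig)) : Prop where
  rmin_le : ∀ A B, Rmin L Sig A B → M.R A B
  le_rmax : ∀ A B, M.R A B → Rmax L Sig A B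
  valuation : ∀ p : ℕ, var p ∈ Sig → M.V p = {A | var p ∈ A.1}

end MuC

namespace MuC

namespace Fml

/-! ### Free variables, negation and substitution -/

-- The proof is an induction on formulas in which `ξ` is replaced by an instance `subst σ φ` in
-- `Sig`: `σ` puts unfolded fixpoint formulas for the free variables of `φ`, and the model `K`
-- assigns these variables sets of states compatible with `σ` (`Compat`). Boolean cases are
-- properties of maximally consistent sets, `□` uses the upper bound on `R`, and `◇` uses the lower
-- bound, which supplies a successor (`LogicVal.exists_successor`). For `νy.φ`, the states
-- containing the instance form a postfixpoint, because `ν` implies its unfolding and the unfolding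
-- is an instance of `φ`.
--
-- For `μy.φ`, unfolding gives nothing. Instead let `Z` be any prefixpoint of the body and let `ζ`
-- be the disjunction of the conjunctions of the states in `Z`, which is finite. If `L` proves
-- `φ[ζ/y] → ζ`, the least prefixpoint rule gives `μy.φ → ζ`, so every state containing `μy.φ`
-- belongs to `Z` (`mem_meaning_mu`). This implication needs a second claim, proved in the same
-- induction (`mem_meaning_of_compat`): if the variables in `X` are replaced by descriptions of
-- their values, then truth of the resulting formula together with a state forces that state into
-- the meaning of `φ`. Such formulas lie outside `Sig`. Continuity makes the claim provable: only
-- `∨`, `∧`, `◇` and `μ` occur above variables of `X`, and the lower bound on `R` handles `◇` for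
-- arbitrary formulas, whereas the upper bound speaks only of boxes in `Sig`.
--
-- Two devices keep the syntax manageable. Provability is tested on Boolean valuations that make `L`
-- true (`IsMucLogic.mem_of_forall_logicVal`). Descriptions have their free variables shifted beyond
-- all variables of `Sig`, so that binders cannot capture them; `IsMucLogic.shift_mem_iff` shows
-- that this does not affect provability.

@[simp] theorem FV_negVar (x : ℕ) (φ : Fml) : FV (negVar x φ) = FV φ := by
  induction φ <;> simp only [negVar, FV, *] <;> split_ifs <;> simp [FV, *]

@[simp] theorem FV_neg (φ : Fml) : FV (neg φ) = FV φ := by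
  induction φ <;> simp [neg, FV, *]

theorem negVar_of_notMem {x : ℕ} {φ : Fml} (h : x ∉ FV φ) : negVar x φ = φ := by
  induction φ with
  | fix η y φ ih =>
    simp only [negVar]
    split_ifs with hy
    · rfl
    · rw [ih]
      intro hx
      exact h (Finset.mem_erase.2 ⟨fun e => hy e.symm, hx⟩)
  | var p => simpa [negVar, FV, eq_comm] using h
  | nvar p => simpa [negVar, FV, eq_comm] using h
  | _ => simp_all [negVar, FV]

theorem negVar_comm (x y : ℕ) (φ : Fml) : negVar x (negVar y φ) = negVar y (negVar x φ) := by
  by_cases hxy : x = y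
  · rw [hxy]
  induction φ with
  | fix η z φ ih =>
    by_cases hx : z = x <;> by_cases hy : z = y <;> simp_all [negVar]
  | var p => by_cases hx : p = x <;> by_cases hy : p = y <;> simp_all [negVar]
  | nvar p => by_cases hx : p = x <;> by_cases hy : p = y <;> simp_all [negVar]
  | _ => simp_all [negVar]

@[simp] theorem negVar_negVar (x : ℕ) (φ : Fml) : negVar x (negVar x φ) = φ := by
  induction φ with
  | fix η z φ ih => by_cases hx : z = x <;> simp_all [negVar]
  | var p => by_cases hx : p = x <;> simp_all [negVar]
  | nvar p => by_cases hx : p = x <;> simp_all [negVar]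
  | _ => simp_all [negVar]

theorem neg_negVar (x : ℕ) (φ : Fml) : neg (negVar x φ) = negVar x (neg φ) := by
  induction φ with
  | fix η z φ ih =>
    by_cases hx : z = x
    · simp [negVar, neg, hx]
    · simp [negVar, neg, hx, ih, negVar_comm z x]
  | var p => by_cases hx : p = x <;> simp_all [negVar, neg]
  | nvar p => by_cases hx : p = x <;> simp_all [negVar, neg]
  | _ => simp_all [negVar, neg]

-- Each negation of a fixpoint formula flips its bound variable once, so the two flips cancel and
-- the identity is syntactic. Dual principles are therefore literal instances of the axioms.
@[simp] theorem neg_neg (φ : Fml) : neg (neg φ) = φ := by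
  induction φ with
  | fix η z φ ih => cases η <;> simp [neg, neg_negVar, ih, Binder.dual]
  | _ => simp_all [neg]

-- Capture-avoiding substitution

/-- The variable that replaces the binder `y` when `σ` is applied to a fixpoint formula with
binder `y` and body `φ`. -/
def rebind (σ : ℕ → Fml) (y : ℕ) (φ : Fml) : ℕ :=
  if y ∈ ((FV φ).erase y).biUnion (fun p => FV (σ p)) then
    (((FV φ).erase y).biUnion (fun p => FV (σ p))).sup id + 1 else y

theorem subst_fix (σ : ℕ → Fml) (η : Binder) (y : ℕ) (φ : Fml) :
    subst σ (fix η y φ) =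
      fix η (rebind σ y φ) (subst (Function.update σ y (var (rebind σ y φ))) φ) := rfl

theorem rebind_notMem {σ : ℕ → Fml} {y p : ℕ} {φ : Fml} (hp : p ∈ FV φ) (hpy : p ≠ y) :
    rebind σ y φ ∉ FV (σ p) := by
  have key : rebind σ y φ ∉ ((FV φ).erase y).biUnion (fun p => FV (σ p)) := by
    unfold rebind
    split_ifs with h
    · intro h'
      have := Finset.le_sup (f := id) h'
      simp only [id] at this
      omega
    · exact h
  intro h
  exact key (Finset.mem_biUnion.2 ⟨p, Finset.mem_erase.2 ⟨hpy, hp⟩, h⟩)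

theorem rebind_eq_self {σ : ℕ → Fml} {y : ℕ} {φ : Fml}
    (h : ∀ p ∈ FV φ, p ≠ y → y ∉ FV (σ p)) : rebind σ y φ = y := by
  unfold rebind
  rw [if_neg]
  simp only [Finset.mem_biUnion, Finset.mem_erase, not_exists, not_and]
  exact fun p hp => h p hp.2 hp.1

/-- The new binder depends only on free variables, so negating or flipping a body does not change
how it is renamed. -/
theorem rebind_congr {σ τ : ℕ → Fml} {y : ℕ} {φ ψ : Fml} (hF : FV φ = FV ψ)
    (h : ∀ p ∈ FV φ, p ≠ y → FV (σ p) = FV (τ p)) : rebind σ y φ = rebind τ y ψ := by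
  have : ((FV φ).erase y).biUnion (fun p => FV (σ p)) =
      ((FV ψ).erase y).biUnion (fun p => FV (τ p)) := by
    rw [← hF]
    refine Finset.biUnion_congr rfl fun p hp => ?_
    exact h p (Finset.mem_of_mem_erase hp) (Finset.ne_of_mem_erase hp)
  unfold rebind
  rw [this]

theorem mem_FV_subst {q : ℕ} {σ : ℕ → Fml} {φ : Fml} :
    q ∈ FV (subst σ φ) ↔ ∃ p ∈ FV φ, q ∈ FV (σ p) := by
  induction φ generalizing σ with
  | fix η y φ ih =>
    rw [subst_fix]
    simp only [FV, Finset.mem_erase, ih]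
    constructor
    · rintro ⟨hq, p, hp, hqp⟩
      by_cases hpy : p = y
      · subst hpy
        simp [FV, hq] at hqp
      · rw [Function.update_of_ne hpy] at hqp
        exact ⟨p, ⟨hpy, hp⟩, hqp⟩
    · rintro ⟨p, ⟨hpy, hp⟩, hqp⟩
      refine ⟨?_, p, hp, by rwa [Function.update_of_ne hpy]⟩
      rintro rfl
      exact rebind_notMem hp hpy hqp
  | var p => simp [subst, FV]
  | nvar p => simp [subst, FV]
  | or φ ψ h1 h2 => simp only [subst, FV, Finset.mem_union, h1, h2, or_and_right, exists_or]
  | and φ ψ h1 h2 => simp only [subst, FV, Finset.mem_union, h1, h2, or_and_right, exists_or]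
  | dia φ h => simp only [subst, FV, h]
  | box φ h => simp only [subst, FV, h]

theorem subst_congr {σ τ : ℕ → Fml} {φ : Fml} (h : ∀ p ∈ FV φ, σ p = τ p) :
    subst σ φ = subst τ φ := by
  induction φ generalizing σ τ with
  | fix η y φ ih =>
    have h' : ∀ p ∈ FV φ, p ≠ y → σ p = τ p := fun p hp hpy =>
      h p (Finset.mem_erase.2 ⟨hpy, hp⟩)
    rw [subst_fix, subst_fix, rebind_congr rfl fun p hp hpy => by rw [h' p hp hpy]]
    congr 1
    refine ih fun p hp => ?_
    by_cases hpy : p = y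
    · subst hpy; simp
    · simp [hpy, h' p hp hpy]
  | var p => exact h p (by simp [FV])
  | nvar p => simp only [subst, h p (by simp [FV])]
  | or φ ψ h1 h2 =>
    simp only [subst, h1 fun p hp => h p (by simp [FV, hp]), h2 fun p hp => h p (by simp [FV, hp])]
  | and φ ψ h1 h2 =>
    simp only [subst, h1 fun p hp => h p (by simp [FV, hp]), h2 fun p hp => h p (by simp [FV, hp])]
  | dia φ ih => simp only [subst, ih fun p hp => h p hp]
  | box φ ih => simp only [subst, ih fun p hp => h p hp]

@[simp] theorem subst_var (φ : Fml) : subst var φ = φ := by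
  induction φ with
  | fix η y φ ih =>
    rw [subst_fix, rebind_eq_self (by simp [FV, eq_comm]), Function.update_eq_self, ih]
  | _ => simp_all [subst, neg]

theorem subst1_of_notMem {x : ℕ} {φ ψ : Fml} (h : x ∉ FV φ) : φ.subst1 x ψ = φ := by
  conv_rhs => rw [← subst_var φ]
  refine subst_congr fun p hp => Function.update_of_ne ?_ _ _
  rintro rfl
  exact h hp

/-- This is what negation under a renamed binder requires. The side condition stops the flip of `z`
from touching occurrences that come from other substituted formulas. -/
theorem subst_negVar {σ : ℕ → Fml} {y z : ℕ} {φ : Fml} (hy : σ y = var z)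
    (hz : ∀ p ∈ FV φ, p ≠ y → z ∉ FV (σ p)) :
    subst σ (negVar y φ) = negVar z (subst σ φ) := by
  induction φ generalizing σ with
  | fix η u φ ih =>
    by_cases hyF : y ∈ FV (fix η u φ)
    · obtain ⟨hyu, hyφ⟩ := Finset.mem_erase.1 hyF
      -- `y` stays free under `u` and is sent to `z`, so capture avoidance keeps the new binder away
      -- from `z`.
      have hw : rebind σ u φ ≠ z := by
        intro e
        have := rebind_notMem (σ := σ) hyφ hyu
        rw [hy, e] at this
        simp [FV] at this
      simp only [negVar, Ne.symm hyu, if_false, subst_fix, hw]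
      rw [rebind_congr (FV_negVar y φ) (fun _ _ _ => rfl)]
      congr 1
      refine ih (by rw [Function.update_of_ne hyu, hy]) fun p hp hpy => ?_
      by_cases hpu : p = u
      · subst hpu
        simp [FV, Ne.symm hw]
      · rw [Function.update_of_ne hpu]
        exact hz p (Finset.mem_erase.2 ⟨hpu, hp⟩) hpy
    · rw [negVar_of_notMem hyF, negVar_of_notMem]
      rw [mem_FV_subst]
      rintro ⟨p, hp, hzp⟩
      refine hz p hp ?_ hzp
      rintro rfl
      exact hyF hp
  | var p =>
    by_cases hp : p = y
    · subst hp; simp [negVar, subst, hy, neg]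
    · simp only [negVar, hp, if_false, subst]
      rw [negVar_of_notMem (hz p (by simp [FV]) hp)]
  | nvar p =>
    by_cases hp : p = y
    · subst hp; simp [negVar, subst, hy, neg]
    · simp only [negVar, hp, if_false, subst]
      rw [negVar_of_notMem]
      simpa using hz p (by simp [FV]) hp
  | or φ ψ h1 h2 =>
    simp only [negVar, subst, h1 hy fun p hp => hz p (by simp [FV, hp]),
      h2 hy fun p hp => hz p (by simp [FV, hp])]
  | and φ ψ h1 h2 =>
    simp only [negVar, subst, h1 hy fun p hp => hz p (by simp [FV, hp]),
      h2 hy fun p hp => hz p (by simp [FV, hp])]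
  | dia φ ih => simp only [negVar, subst, ih hy fun p hp => hz p hp]
  | box φ ih => simp only [negVar, subst, ih hy fun p hp => hz p hp]

theorem subst_neg (σ : ℕ → Fml) (φ : Fml) : subst σ (neg φ) = neg (subst σ φ) := by
  induction φ generalizing σ with
  | fix η y φ ih =>
    simp only [neg, subst_fix]
    rw [rebind_congr (ψ := φ) (τ := σ) (by simp) (fun _ _ _ => rfl),
      subst_negVar (z := rebind σ y φ) (by simp), ih]
    intro p hp hpy
    rw [Function.update_of_ne hpy]
    exact rebind_notMem (by simpa using hp) hpy
  | _ => simp_all [neg, subst]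

/-- Substituting `∼σ(x)` for the flipped variable `x` is substituting `σ(x)` for `x`. -/
theorem subst_negVar_of_eq_neg {σ τ : ℕ → Fml} {x : ℕ} {φ : Fml} (hx : τ x = neg (σ x))
    (h : ∀ p, p ≠ x → τ p = σ p) : subst τ (negVar x φ) = subst σ φ := by
  induction φ generalizing σ τ with
  | fix η u φ ih =>
    by_cases hu : u = x
    · subst hu
      simp only [negVar, if_true]
      refine subst_congr fun p hp => h p (Finset.ne_of_mem_erase hp)
    · simp only [negVar, hu, if_false, subst_fix]
      rw [rebind_congr (ψ := φ) (τ := σ) (by simp)]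
      · congr 1
        refine ih (by simp [Ne.symm hu, hx]) fun p hp => ?_
        by_cases hpu : p = u
        · subst hpu; simp
        · simp [hpu, h p hp]
      · intro p _ _
        by_cases hp : p = x
        · subst hp; simp [hx]
        · rw [h p hp]
  | var p => by_cases hp : p = x <;> simp_all [negVar, subst]
  | nvar p => by_cases hp : p = x <;> simp_all [negVar, subst]
  | or φ ψ h1 h2 => simp only [negVar, subst, h1 hx h, h2 hx h]
  | and φ ψ h1 h2 => simp only [negVar, subst, h1 hx h, h2 hx h]
  | dia φ ih => simp only [negVar, subst, ih hx h]
  | box φ ih => simp only [negVar, subst, ih hx h]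

theorem subst_fix_of_noCapture {σ : ℕ → Fml} {η : Binder} {y : ℕ} {φ : Fml}
    (h : ∀ p ∈ FV φ, p ≠ y → y ∉ FV (σ p)) :
    subst σ (fix η y φ) = fix η y (subst (Function.update σ y (var y)) φ) := by
  rw [subst_fix, rebind_eq_self h]

/-- Substitutions compose as long as no bound variable is captured. -/
theorem subst_subst {σ τ : ℕ → Fml} {φ : Fml}
    (hσ : ∀ p ∈ FV φ, ∀ u ∈ BV φ, u ≠ p → u ∉ FV (σ p))
    (hτ : ∀ p ∈ FV φ, ∀ u ∈ BV φ, u ≠ p → u ∉ FV (subst τ (σ p))) :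
    subst τ (subst σ φ) = subst (fun p => subst τ (σ p)) φ := by
  induction φ generalizing σ τ with
  | fix η u φ ih =>
    have hu : u ∈ BV (fix η u φ) := by simp [BV]
    have h1 : ∀ p ∈ FV φ, p ≠ u → u ∉ FV (σ p) := fun p hp hpu =>
      hσ p (Finset.mem_erase.2 ⟨hpu, hp⟩) u hu (Ne.symm hpu)
    have h2 : ∀ p ∈ FV φ, p ≠ u → u ∉ FV (subst τ (σ p)) := fun p hp hpu =>
      hτ p (Finset.mem_erase.2 ⟨hpu, hp⟩) u hu (Ne.symm hpu)
    have h4 : ∀ p ∈ FV φ, p ≠ u → subst (Function.update τ u (var u)) (σ p) = subst τ (σ p) := by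
      intro p hp hpu
      refine subst_congr fun q hq => Function.update_of_ne ?_ _ _
      rintro rfl
      exact h1 p hp hpu hq
    rw [subst_fix_of_noCapture h1, subst_fix_of_noCapture, subst_fix_of_noCapture h2, ih]
    · congr 1
      refine subst_congr fun p hp => ?_
      by_cases hpu : p = u
      · subst hpu; simp [subst]
      · simp only [Function.update_of_ne hpu, h4 p hp hpu]
    · intro p hp w hw hwp
      by_cases hpu : p = u
      · subst hpu; simpa [FV] using hwp
      · rw [Function.update_of_ne hpu]
        exact hσ p (Finset.mem_erase.2 ⟨hpu, hp⟩) w (by simp [BV, hw]) hwp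
    · intro p hp w hw hwp
      by_cases hpu : p = u
      · subst hpu; simpa [FV, subst] using hwp
      · rw [Function.update_of_ne hpu, h4 p hp hpu]
        exact hτ p (Finset.mem_erase.2 ⟨hpu, hp⟩) w (by simp [BV, hw]) hwp
    · intro q hq hqu huq
      obtain ⟨p, hp, hqp⟩ := mem_FV_subst.1 hq
      by_cases hpu : p = u
      · subst hpu
        simp [FV] at hqp
        exact hqu hqp
      · rw [Function.update_of_ne hpu] at hqp
        exact h2 p hp hpu (mem_FV_subst.2 ⟨q, hqp, huq⟩)
  | var p => rfl
  | nvar p => simp only [subst, subst_neg]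
  | or φ ψ h1 h2 =>
    simp only [subst]
    rw [h1, h2] <;> intro p hp u hu
    · exact hσ p (by simp [FV, hp]) u (by simp [BV, hu])
    · exact hτ p (by simp [FV, hp]) u (by simp [BV, hu])
    · exact hσ p (by simp [FV, hp]) u (by simp [BV, hu])
    · exact hτ p (by simp [FV, hp]) u (by simp [BV, hu])
  | and φ ψ h1 h2 =>
    simp only [subst]
    rw [h1, h2] <;> intro p hp u hu
    · exact hσ p (by simp [FV, hp]) u (by simp [BV, hu])
    · exact hτ p (by simp [FV, hp]) u (by simp [BV, hu])
    · exact hσ p (by simp [FV, hp]) u (by simp [BV, hu])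
    · exact hτ p (by simp [FV, hp]) u (by simp [BV, hu])
  | dia φ ih => simp only [subst]; rw [ih hσ hτ]
  | box φ ih => simp only [subst]; rw [ih hσ hτ]

/-- Substituting for the binder after substituting in the body, without capture. -/
theorem subst1_subst_update {σ : ℕ → Fml} {y : ℕ} {φ θ : Fml}
    (hσ : ∀ p ∈ FV φ, p ≠ y → y ∉ FV (σ p) ∧ ∀ u ∈ BV φ, u ∉ FV (σ p))
    (hθ : ∀ u ∈ BV φ, u ∉ FV θ) :
    (subst (Function.update σ y (var y)) φ).subst1 y θ = subst (Function.update σ y θ) φ := by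
  have h : ∀ p ∈ FV φ, subst (Function.update var y θ) (Function.update σ y (var y) p) =
      Function.update σ y θ p := by
    intro p hp
    by_cases hpy : p = y
    · subst hpy; simp [subst]
    · simp only [Function.update_of_ne hpy]
      exact subst1_of_notMem (hσ p hp hpy).1
  rw [subst1, subst_subst, subst_congr h]
  · intro p hp u hu hup
    by_cases hpy : p = y
    · subst hpy; simpa [FV] using hup
    · rw [Function.update_of_ne hpy]
      exact (hσ p hp hpy).2 u hu
  · intro p hp u hu hup
    rw [h p hp]
    by_cases hpy : p = y
    · subst hpy; simpa using hθ u hu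
    · rw [Function.update_of_ne hpy]
      exact (hσ p hp hpy).2 u hu

-- Polarity of free occurrences

/-- The set of variables with a free negative occurrence. -/
def negLits : Fml → Finset ℕ
  | var _ => ∅
  | nvar p => {p}
  | or φ ψ => negLits φ ∪ negLits ψ
  | and φ ψ => negLits φ ∪ negLits ψ
  | dia φ => negLits φ
  | box φ => negLits φ
  | fix _ x φ => (negLits φ).erase x

theorem negLits_subset_FV (φ : Fml) : negLits φ ⊆ FV φ := by
  induction φ with
  | fix η x φ ih => exact Finset.erase_subset_erase x ih
  | or φ ψ h1 h2 => exact Finset.union_subset_union h1 h2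
  | and φ ψ h1 h2 => exact Finset.union_subset_union h1 h2
  | dia φ ih => exact ih
  | box φ ih => exact ih
  | _ => simp [negLits, FV]

open Classical in
/-- Flip the polarity of the free occurrences of all variables in `X`. -/
noncomputable def negOn : Set ℕ → Fml → Fml
  | X, var p => if p ∈ X then nvar p else var p
  | X, nvar p => if p ∈ X then var p else nvar p
  | X, or φ ψ => or (negOn X φ) (negOn X ψ)
  | X, and φ ψ => and (negOn X φ) (negOn X ψ)
  | X, dia φ => dia (negOn X φ)
  | X, box φ => box (negOn X φ)
  | X, fix η y φ => fix η y (negOn (X \ {y}) φ)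

theorem negOn_of_disjoint {X : Set ℕ} {φ : Fml} (h : ∀ x ∈ X, x ∉ FV φ) : negOn X φ = φ := by
  induction φ generalizing X with
  | fix η y φ ih =>
    simp only [negOn]
    rw [ih]
    intro x hx hxφ
    exact h x hx.1 (Finset.mem_erase.2 ⟨hx.2, hxφ⟩)
  | var p => simp [negOn]; intro hp; exact h p hp (by simp [FV])
  | nvar p => simp [negOn]; intro hp; exact h p hp (by simp [FV])
  | or φ ψ h1 h2 =>
    simp only [negOn, h1 fun x hx hx' => h x hx (by simp [FV, hx']),
      h2 fun x hx hx' => h x hx (by simp [FV, hx'])]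
  | and φ ψ h1 h2 =>
    simp only [negOn, h1 fun x hx hx' => h x hx (by simp [FV, hx']),
      h2 fun x hx hx' => h x hx (by simp [FV, hx'])]
  | dia φ ih => simp only [negOn, ih fun x hx hx' => h x hx hx']
  | box φ ih => simp only [negOn, ih fun x hx hx' => h x hx hx']

theorem negOn_negVar {X : Set ℕ} {y : ℕ} (hy : y ∉ X) (φ : Fml) :
    negOn X (negVar y φ) = negOn (X ∪ {y}) φ := by
  induction φ generalizing X with
  | fix η u φ ih =>
    by_cases hu : u = y
    · subst hu
      simp only [negVar, if_true, negOn]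
      congr 2
      ext a
      simp only [Set.mem_sdiff, Set.mem_union, Set.mem_singleton_iff]
      tauto
    · simp only [negVar, hu, if_false, negOn]
      rw [ih fun h => hy h.1]
      congr 2
      ext a
      simp only [Set.mem_sdiff, Set.mem_union, Set.mem_singleton_iff]
      have : a = y → a ≠ u := fun h1 h2 => hu (h2 ▸ h1)
      tauto
  | var p =>
    by_cases hp : p = y
    · simp_all [negVar, negOn]
    · simp only [negVar, negOn, hp, if_false]
      by_cases hX : p ∈ X
      · rw [if_pos hX, if_pos (show p ∈ X ∪ {y} from Or.inl hX)]
      · rw [if_neg hX, if_neg (show p ∉ X ∪ {y} by simp [hX, hp])]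
  | nvar p =>
    by_cases hp : p = y
    · simp_all [negVar, negOn]
    · simp only [negVar, negOn, hp, if_false]
      by_cases hX : p ∈ X
      · rw [if_pos hX, if_pos (show p ∈ X ∪ {y} from Or.inl hX)]
      · rw [if_neg hX, if_neg (show p ∉ X ∪ {y} by simp [hX, hp])]
  | or φ ψ h1 h2 => simp only [negVar, negOn, h1 hy, h2 hy]
  | and φ ψ h1 h2 => simp only [negVar, negOn, h1 hy, h2 hy]
  | dia φ ih => simp only [negVar, negOn, ih hy]
  | box φ ih => simp only [negVar, negOn, ih hy]

theorem negOn_singleton (x : ℕ) (φ : Fml) : negOn {x} φ = negVar x φ := by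
  have := negOn_negVar (Set.notMem_empty x) φ
  rw [negOn_of_disjoint (by simp), Set.empty_union] at this
  exact this.symm

end Fml

open Fml

/-! ### Closure properties of the fragments -/

theorem Con.antitone {X Y : Set ℕ} {φ : Fml} (h : Con X φ) (hYX : Y ⊆ X) : Con Y φ := by
  induction φ generalizing X Y with
  | var p =>
    by_cases hp : p ∈ Y
    · exact Con.var hp
    · refine Con.free (IsFormula.var p) fun x hx => ?_
      rintro hxp
      rw [FV, Finset.mem_singleton] at hxp
      exact hp (hxp ▸ hx)
  | nvar p => cases h with | free h1 h2 => exact Con.free h1 fun x hx => h2 x (hYX hx)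
  | or φ ψ h1 h2 =>
    cases h with
    | free a b => exact Con.free a fun x hx => b x (hYX hx)
    | or a b => exact Con.or (h1 a hYX) (h2 b hYX)
  | and φ ψ h1 h2 =>
    cases h with
    | free a b => exact Con.free a fun x hx => b x (hYX hx)
    | and a b => exact Con.and (h1 a hYX) (h2 b hYX)
  | dia φ ih =>
    cases h with
    | free a b => exact Con.free a fun x hx => b x (hYX hx)
    | dia a => exact Con.dia (ih a hYX)
  | box φ ih => cases h with | free a b => exact Con.free a fun x hx => b x (hYX hx)
  | fix η y φ ih =>
    cases h with
    | free a b => exact Con.free a fun x hx => b x (hYX hx)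
    | mu a => exact Con.mu (ih a (Set.union_subset_union_left _ hYX))

theorem Cocon.antitone {X Y : Set ℕ} {φ : Fml} (h : Cocon X φ) (hYX : Y ⊆ X) : Cocon Y φ := by
  induction φ generalizing X Y with
  | var p =>
    by_cases hp : p ∈ Y
    · exact Cocon.var hp
    · refine Cocon.free (IsFormula.var p) fun x hx => ?_
      rintro hxp
      rw [FV, Finset.mem_singleton] at hxp
      exact hp (hxp ▸ hx)
  | nvar p => cases h with | free h1 h2 => exact Cocon.free h1 fun x hx => h2 x (hYX hx)
  | or φ ψ h1 h2 =>
    cases h with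
    | free a b => exact Cocon.free a fun x hx => b x (hYX hx)
    | or a b => exact Cocon.or (h1 a hYX) (h2 b hYX)
  | and φ ψ h1 h2 =>
    cases h with
    | free a b => exact Cocon.free a fun x hx => b x (hYX hx)
    | and a b => exact Cocon.and (h1 a hYX) (h2 b hYX)
  | box φ ih =>
    cases h with
    | free a b => exact Cocon.free a fun x hx => b x (hYX hx)
    | box a => exact Cocon.box (ih a hYX)
  | dia φ ih => cases h with | free a b => exact Cocon.free a fun x hx => b x (hYX hx)
  | fix η y φ ih =>
    cases h with
    | free a b => exact Cocon.free a fun x hx => b x (hYX hx)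
    | nu a => exact Cocon.nu (ih a (Set.union_subset_union_left _ hYX))

theorem Con.isFormula {X : Set ℕ} {φ : Fml} (h : Con X φ) : IsFormula φ := by
  induction φ generalizing X with
  | var p => exact IsFormula.var p
  | nvar p => exact IsFormula.nvar p
  | or φ ψ h1 h2 => cases h with
    | free a b => exact a
    | or a b => exact IsFormula.or (h1 a) (h2 b)
  | and φ ψ h1 h2 => cases h with
    | free a b => exact a
    | and a b => exact IsFormula.and (h1 a) (h2 b)
  | dia φ ih => cases h with
    | free a b => exact a
    | dia a => exact IsFormula.dia (ih a)
  | box φ ih => cases h with | free a b => exact a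
  | fix η y φ ih => cases h with
    | free a b => exact a
    | mu a => exact IsFormula.mu (a.antitone Set.subset_union_right)

theorem Cocon.isFormula {X : Set ℕ} {φ : Fml} (h : Cocon X φ) : IsFormula φ := by
  induction φ generalizing X with
  | var p => exact IsFormula.var p
  | nvar p => exact IsFormula.nvar p
  | or φ ψ h1 h2 => cases h with
    | free a b => exact a
    | or a b => exact IsFormula.or (h1 a) (h2 b)
  | and φ ψ h1 h2 => cases h with
    | free a b => exact a
    | and a b => exact IsFormula.and (h1 a) (h2 b)
  | box φ ih => cases h with
    | free a b => exact a
    | box a => exact IsFormula.box (ih a)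
  | dia φ ih => cases h with | free a b => exact a
  | fix η y φ ih => cases h with
    | free a b => exact a
    | nu a => exact IsFormula.nu (a.antitone Set.subset_union_right)

/-- Fixpoint variables thus never occur negated, so negative literals keep their original reading
when the induction passes a binder. -/
theorem Con.notMem_negLits {X : Set ℕ} {φ : Fml} (h : Con X φ) {x : ℕ} (hx : x ∈ X) :
    x ∉ negLits φ := by
  have hfree : ∀ {φ : Fml}, (∀ x ∈ X, x ∉ FV φ) → x ∉ negLits φ := fun h h' =>
    h x hx (negLits_subset_FV _ h')
  induction φ generalizing X with
  | var p => simp [negLits]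
  | nvar p => cases h with | free a b => exact hfree b
  | or φ ψ h1 h2 => cases h with
    | free a b => exact hfree b
    | or a b => simp [negLits, h1 a hx hfree, h2 b hx hfree]
  | and φ ψ h1 h2 => cases h with
    | free a b => exact hfree b
    | and a b => simp [negLits, h1 a hx hfree, h2 b hx hfree]
  | dia φ ih => cases h with
    | free a b => exact hfree b
    | dia a => exact ih a hx hfree
  | box φ ih => cases h with | free a b => exact hfree b
  | fix η y φ ih => cases h with
    | free a b => exact hfree b
    | mu a =>
      exact fun h' => ih a (Or.inl hx)
        (fun h h'' => h x (Or.inl hx) (negLits_subset_FV _ h'')) (Finset.mem_of_mem_erase h')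

theorem Cocon.notMem_negLits {X : Set ℕ} {φ : Fml} (h : Cocon X φ) {x : ℕ} (hx : x ∈ X) :
    x ∉ negLits φ := by
  have hfree : ∀ {φ : Fml}, (∀ x ∈ X, x ∉ FV φ) → x ∉ negLits φ := fun h h' =>
    h x hx (negLits_subset_FV _ h')
  induction φ generalizing X with
  | var p => simp [negLits]
  | nvar p => cases h with | free a b => exact hfree b
  | or φ ψ h1 h2 => cases h with
    | free a b => exact hfree b
    | or a b => simp [negLits, h1 a hx hfree, h2 b hx hfree]
  | and φ ψ h1 h2 => cases h with
    | free a b => exact hfree b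
    | and a b => simp [negLits, h1 a hx hfree, h2 b hx hfree]
  | box φ ih => cases h with
    | free a b => exact hfree b
    | box a => exact ih a hx hfree
  | dia φ ih => cases h with | free a b => exact hfree b
  | fix η y φ ih => cases h with
    | free a b => exact hfree b
    | nu a =>
      exact fun h' => ih a (Or.inl hx)
        (fun h h'' => h x (Or.inl hx) (negLits_subset_FV _ h'')) (Finset.mem_of_mem_erase h')

/-- Needed when substitution passes a binder: the substituted formulas must also be continuous in
the renamed binder, which is not free in them. -/
theorem Con.insert_fresh {X : Set ℕ} {w : ℕ} {φ : Fml} (h : Con X φ) (hw : w ∉ FV φ) :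
    Con (X ∪ {w}) φ := by
  have hfree : ∀ {φ : Fml}, IsFormula φ → w ∉ FV φ → (∀ x ∈ X, x ∉ FV φ) → Con (X ∪ {w}) φ := by
    rintro φ hφ hw h
    refine Con.free hφ ?_
    rintro x (hx | rfl)
    exacts [h x hx, hw]
  induction φ generalizing X with
  | var p => cases h with
    | free a b => exact hfree a hw b
    | var hp => exact Con.var (Or.inl hp)
  | nvar p => cases h with | free a b => exact hfree a hw b
  | or φ ψ h1 h2 =>
    cases h with
    | free a b => exact hfree a hw b
    | or a b =>
      simp only [FV, Finset.mem_union, not_or] at hw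
      exact Con.or (h1 a hw.1 hfree) (h2 b hw.2 hfree)
  | and φ ψ h1 h2 =>
    cases h with
    | free a b => exact hfree a hw b
    | and a b =>
      simp only [FV, Finset.mem_union, not_or] at hw
      exact Con.and (h1 a hw.1 hfree) (h2 b hw.2 hfree)
  | dia φ ih => cases h with
    | free a b => exact hfree a hw b
    | dia a => exact Con.dia (ih a hw hfree)
  | box φ ih => cases h with | free a b => exact hfree a hw b
  | fix η y φ ih => cases h with
    | free a b => exact hfree a hw b
    | mu a =>
      refine Con.mu ?_
      by_cases hwy : w = y
      · subst hwy
        exact a.antitone (by simp)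
      · rw [Set.union_right_comm]
        refine ih a (fun h' => hw (Finset.mem_erase.2 ⟨hwy, h'⟩)) ?_
        rintro φ hφ hw h
        refine Con.free hφ ?_
        rintro x (hx | rfl)
        exacts [h x hx, hw]

theorem Cocon.insert_fresh {X : Set ℕ} {w : ℕ} {φ : Fml} (h : Cocon X φ) (hw : w ∉ FV φ) :
    Cocon (X ∪ {w}) φ := by
  have hfree : ∀ {φ : Fml}, IsFormula φ → w ∉ FV φ → (∀ x ∈ X, x ∉ FV φ) →
      Cocon (X ∪ {w}) φ := by
    rintro φ hφ hw h
    refine Cocon.free hφ ?_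
    rintro x (hx | rfl)
    exacts [h x hx, hw]
  induction φ generalizing X with
  | var p => cases h with
    | free a b => exact hfree a hw b
    | var hp => exact Cocon.var (Or.inl hp)
  | nvar p => cases h with | free a b => exact hfree a hw b
  | or φ ψ h1 h2 =>
    cases h with
    | free a b => exact hfree a hw b
    | or a b =>
      simp only [FV, Finset.mem_union, not_or] at hw
      exact Cocon.or (h1 a hw.1 hfree) (h2 b hw.2 hfree)
  | and φ ψ h1 h2 =>
    cases h with
    | free a b => exact hfree a hw b
    | and a b =>
      simp only [FV, Finset.mem_union, not_or] at hw
      exact Cocon.and (h1 a hw.1 hfree) (h2 b hw.2 hfree)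
  | box φ ih => cases h with
    | free a b => exact hfree a hw b
    | box a => exact Cocon.box (ih a hw hfree)
  | dia φ ih => cases h with | free a b => exact hfree a hw b
  | fix η y φ ih => cases h with
    | free a b => exact hfree a hw b
    | nu a =>
      refine Cocon.nu ?_
      by_cases hwy : w = y
      · subst hwy
        exact a.antitone (by simp)
      · rw [Set.union_right_comm]
        refine ih a (fun h' => hw (Finset.mem_erase.2 ⟨hwy, h'⟩)) ?_
        rintro φ hφ hw h
        refine Cocon.free hφ ?_
        rintro x (hx | rfl)
        exacts [h x hx, hw]

/-- Negation exchanges the continuous and the cocontinuous fragment. -/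
theorem neg_fragments (φ : Fml) :
    (IsFormula φ → IsFormula (neg φ)) ∧
    (∀ X, Con X φ → Cocon X (negOn X (neg φ))) ∧
    (∀ X, Cocon X φ → Con X (negOn X (neg φ))) := by
  have hC : ∀ {φ : Fml} {X : Set ℕ}, (IsFormula φ → IsFormula (neg φ)) → IsFormula φ →
      (∀ x ∈ X, x ∉ FV φ) →
      Cocon X (negOn X (neg φ)) ∧ Con X (negOn X (neg φ)) := by
    intro φ X h a b
    rw [negOn_of_disjoint (by simpa using b)]
    exact ⟨Cocon.free (h a) (by simpa using b), Con.free (h a) (by simpa using b)⟩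
  -- Negating a binder flips `y`, and the outer flip of `X` skips the bound `y`; together they flip
  -- `X ∪ {y}`, as the induction hypothesis asks.
  have hU : ∀ (X : Set ℕ) (y : ℕ) (φ : Fml),
      negOn (X \ {y}) (negVar y φ) = negOn (X ∪ {y}) φ := by
    intro X y φ
    rw [negOn_negVar (by simp), Set.sdiff_union_self]
  induction φ with
  | var p =>
    have h1 : IsFormula (var p) → IsFormula (neg (var p)) := fun _ => IsFormula.nvar p
    refine ⟨h1, fun X h => ?_, fun X h => ?_⟩
    · cases h with
      | free a b => exact (hC h1 a b).1
      | var hp => simpa [neg, negOn, hp] using Cocon.var hp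
    · cases h with
      | free a b => exact (hC h1 a b).2
      | var hp => simpa [neg, negOn, hp] using Con.var hp
  | nvar p =>
    have h1 : IsFormula (nvar p) → IsFormula (neg (nvar p)) := fun _ => IsFormula.var p
    refine ⟨h1, fun X h => ?_, fun X h => ?_⟩
    · cases h with | free a b => exact (hC h1 a b).1
    · cases h with | free a b => exact (hC h1 a b).2
  | or φ ψ ih1 ih2 =>
    have h1 : IsFormula (or φ ψ) → IsFormula (neg (or φ ψ)) := fun h => by
      cases h with | or a b => exact IsFormula.and (ih1.1 a) (ih2.1 b)
    refine ⟨h1, fun X h => ?_, fun X h => ?_⟩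
    · cases h with
      | free a b => exact (hC h1 a b).1
      | or a b => exact Cocon.and (ih1.2.1 X a) (ih2.2.1 X b)
    · cases h with
      | free a b => exact (hC h1 a b).2
      | or a b => exact Con.and (ih1.2.2 X a) (ih2.2.2 X b)
  | and φ ψ ih1 ih2 =>
    have h1 : IsFormula (and φ ψ) → IsFormula (neg (and φ ψ)) := fun h => by
      cases h with | and a b => exact IsFormula.or (ih1.1 a) (ih2.1 b)
    refine ⟨h1, fun X h => ?_, fun X h => ?_⟩
    · cases h with
      | free a b => exact (hC h1 a b).1
      | and a b => exact Cocon.or (ih1.2.1 X a) (ih2.2.1 X b)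
    · cases h with
      | free a b => exact (hC h1 a b).2
      | and a b => exact Con.or (ih1.2.2 X a) (ih2.2.2 X b)
  | dia φ ih =>
    have h1 : IsFormula (dia φ) → IsFormula (neg (dia φ)) := fun h => by
      cases h with | dia a => exact IsFormula.box (ih.1 a)
    refine ⟨h1, fun X h => ?_, fun X h => ?_⟩
    · cases h with
      | free a b => exact (hC h1 a b).1
      | dia a => exact Cocon.box (ih.2.1 X a)
    · cases h with | free a b => exact (hC h1 a b).2
  | box φ ih =>
    have h1 : IsFormula (box φ) → IsFormula (neg (box φ)) := fun h => by
      cases h with | box a => exact IsFormula.dia (ih.1 a)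
    refine ⟨h1, fun X h => ?_, fun X h => ?_⟩
    · cases h with | free a b => exact (hC h1 a b).1
    · cases h with
      | free a b => exact (hC h1 a b).2
      | box a => exact Con.dia (ih.2.2 X a)
  | fix η y φ ih =>
    have h1 : IsFormula (fix η y φ) → IsFormula (neg (fix η y φ)) := fun h => by
      cases h with
      | mu a => exact IsFormula.nu (negOn_singleton y _ ▸ ih.2.1 _ a)
      | nu a => exact IsFormula.mu (negOn_singleton y _ ▸ ih.2.2 _ a)
    refine ⟨h1, fun X h => ?_, fun X h => ?_⟩
    · cases h with
      | free a b => exact (hC h1 a b).1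
      | mu a =>
        refine Cocon.nu ?_
        rw [hU]
        exact ih.2.1 _ a
    · cases h with
      | free a b => exact (hC h1 a b).2
      | nu a =>
        refine Con.mu ?_
        rw [hU]
        exact ih.2.2 _ a

theorem IsFormula.neg {φ : Fml} (h : IsFormula φ) : IsFormula φ.neg := (neg_fragments φ).1 h

theorem Cocon.negVar_neg {x : ℕ} {φ : Fml} (h : Cocon {x} φ) : Con {x} (negVar x φ.neg) :=
  negOn_singleton x _ ▸ (neg_fragments φ).2.2 _ h

theorem IsFormula.imp {φ ψ : Fml} (h : IsFormula φ) (h' : IsFormula ψ) : IsFormula (imp φ ψ) :=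
  IsFormula.or h.neg h'

theorem isFormula_bot : IsFormula bot := IsFormula.and (IsFormula.var 0) (IsFormula.nvar 0)

theorem isFormula_top : IsFormula top := IsFormula.or (IsFormula.var 0) (IsFormula.nvar 0)

/-- Substitution preserves formulas and the two fragments. -/
theorem subst_fragments (φ : Fml) :
    (∀ σ : ℕ → Fml, (∀ p, IsFormula (σ p)) → IsFormula φ → IsFormula (subst σ φ)) ∧
    (∀ (σ : ℕ → Fml) (X Z : Set ℕ), (∀ p, IsFormula (σ p)) → (∀ p ∈ X, p ∈ FV φ → Con Z (σ p)) →
      (∀ p ∈ FV φ, p ∉ X → ∀ z ∈ Z, z ∉ FV (σ p)) → Con X φ → Con Z (subst σ φ)) ∧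
    (∀ (σ : ℕ → Fml) (X Z : Set ℕ), (∀ p, IsFormula (σ p)) →
      (∀ p ∈ X, p ∈ FV φ → Cocon Z (σ p)) →
      (∀ p ∈ FV φ, p ∉ X → ∀ z ∈ Z, z ∉ FV (σ p)) → Cocon X φ → Cocon Z (subst σ φ)) := by
  have hfree : ∀ {φ : Fml} {σ : ℕ → Fml} {X Z : Set ℕ},
      (∀ p ∈ FV φ, p ∉ X → ∀ z ∈ Z, z ∉ FV (σ p)) → (∀ x ∈ X, x ∉ FV φ) →
      ∀ z ∈ Z, z ∉ FV (subst σ φ) := by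
    intro φ σ X Z h h' z hz hz'
    obtain ⟨p, hp, hzp⟩ := mem_FV_subst.1 hz'
    exact h p hp (fun hX => h' p hX hp) z hz hzp
  have hupd : ∀ {σ : ℕ → Fml} {y w : ℕ}, (∀ p, IsFormula (σ p)) →
      ∀ p, IsFormula (Function.update σ y (var w) p) := by
    intro σ y w h p
    by_cases hp : p = y
    · subst hp; simpa using IsFormula.var w
    · simpa [hp] using h p
  have hout : ∀ {φ : Fml} {σ : ℕ → Fml} {X Z : Set ℕ} {η : Binder} {y : ℕ},
      (∀ p ∈ FV (fix η y φ), p ∉ X → ∀ z ∈ Z, z ∉ FV (σ p)) →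
      ∀ p ∈ FV φ, p ∉ X ∪ {y} → ∀ z ∈ Z ∪ {rebind σ y φ},
        z ∉ FV (Function.update σ y (var (rebind σ y φ)) p) := by
    rintro φ σ X Z η y h p hp hpX z hz
    have hpy : p ≠ y := fun e => hpX (Or.inr e)
    rw [Function.update_of_ne hpy]
    rcases hz with hz | rfl
    · exact h p (Finset.mem_erase.2 ⟨hpy, hp⟩) (fun e => hpX (Or.inl e)) z hz
    · exact rebind_notMem hp hpy
  induction φ with
  | var p =>
    refine ⟨fun σ h _ => h p, fun σ X Z h hX hZ hc => ?_, fun σ X Z h hX hZ hc => ?_⟩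
    · cases hc with
      | free a b => exact Con.free (h p) (hfree hZ b)
      | var hp => exact hX p hp (by simp [FV])
    · cases hc with
      | free a b => exact Cocon.free (h p) (hfree hZ b)
      | var hp => exact hX p hp (by simp [FV])
  | nvar p =>
    refine ⟨fun σ h _ => (h p).neg, fun σ X Z h hX hZ hc => ?_, fun σ X Z h hX hZ hc => ?_⟩
    · cases hc with | free a b => exact Con.free (h p).neg (hfree hZ b)
    · cases hc with | free a b => exact Cocon.free (h p).neg (hfree hZ b)
  | or φ ψ ih1 ih2 =>
    have h1 : ∀ σ : ℕ → Fml, (∀ p, IsFormula (σ p)) → IsFormula (or φ ψ) →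
        IsFormula (subst σ (or φ ψ)) := fun σ h hf => by
      cases hf with | or a b => exact IsFormula.or (ih1.1 σ h a) (ih2.1 σ h b)
    refine ⟨h1, fun σ X Z h hX hZ hc => ?_, fun σ X Z h hX hZ hc => ?_⟩
    · cases hc with
      | free a b => exact Con.free (h1 σ h a) (hfree hZ b)
      | or a b =>
        exact Con.or
          (ih1.2.1 σ X Z h (fun p hp hp' => hX p hp (by simp [FV, hp']))
            (fun p hp => hZ p (by simp [FV, hp])) a)
          (ih2.2.1 σ X Z h (fun p hp hp' => hX p hp (by simp [FV, hp']))
            (fun p hp => hZ p (by simp [FV, hp])) b)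
    · cases hc with
      | free a b => exact Cocon.free (h1 σ h a) (hfree hZ b)
      | or a b =>
        exact Cocon.or
          (ih1.2.2 σ X Z h (fun p hp hp' => hX p hp (by simp [FV, hp']))
            (fun p hp => hZ p (by simp [FV, hp])) a)
          (ih2.2.2 σ X Z h (fun p hp hp' => hX p hp (by simp [FV, hp']))
            (fun p hp => hZ p (by simp [FV, hp])) b)
  | and φ ψ ih1 ih2 =>
    have h1 : ∀ σ : ℕ → Fml, (∀ p, IsFormula (σ p)) → IsFormula (and φ ψ) →
        IsFormula (subst σ (and φ ψ)) := fun σ h hf => by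
      cases hf with | and a b => exact IsFormula.and (ih1.1 σ h a) (ih2.1 σ h b)
    refine ⟨h1, fun σ X Z h hX hZ hc => ?_, fun σ X Z h hX hZ hc => ?_⟩
    · cases hc with
      | free a b => exact Con.free (h1 σ h a) (hfree hZ b)
      | and a b =>
        exact Con.and
          (ih1.2.1 σ X Z h (fun p hp hp' => hX p hp (by simp [FV, hp']))
            (fun p hp => hZ p (by simp [FV, hp])) a)
          (ih2.2.1 σ X Z h (fun p hp hp' => hX p hp (by simp [FV, hp']))
            (fun p hp => hZ p (by simp [FV, hp])) b)
    · cases hc with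
      | free a b => exact Cocon.free (h1 σ h a) (hfree hZ b)
      | and a b =>
        exact Cocon.and
          (ih1.2.2 σ X Z h (fun p hp hp' => hX p hp (by simp [FV, hp']))
            (fun p hp => hZ p (by simp [FV, hp])) a)
          (ih2.2.2 σ X Z h (fun p hp hp' => hX p hp (by simp [FV, hp']))
            (fun p hp => hZ p (by simp [FV, hp])) b)
  | dia φ ih =>
    have h1 : ∀ σ : ℕ → Fml, (∀ p, IsFormula (σ p)) → IsFormula (dia φ) →
        IsFormula (subst σ (dia φ)) := fun σ h hf => by
      cases hf with | dia a => exact IsFormula.dia (ih.1 σ h a)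
    refine ⟨h1, fun σ X Z h hX hZ hc => ?_, fun σ X Z h hX hZ hc => ?_⟩
    · cases hc with
      | free a b => exact Con.free (h1 σ h a) (hfree hZ b)
      | dia a => exact Con.dia (ih.2.1 σ X Z h hX hZ a)
    · cases hc with | free a b => exact Cocon.free (h1 σ h a) (hfree hZ b)
  | box φ ih =>
    have h1 : ∀ σ : ℕ → Fml, (∀ p, IsFormula (σ p)) → IsFormula (box φ) →
        IsFormula (subst σ (box φ)) := fun σ h hf => by
      cases hf with | box a => exact IsFormula.box (ih.1 σ h a)
    refine ⟨h1, fun σ X Z h hX hZ hc => ?_, fun σ X Z h hX hZ hc => ?_⟩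
    · cases hc with | free a b => exact Con.free (h1 σ h a) (hfree hZ b)
    · cases hc with
      | free a b => exact Cocon.free (h1 σ h a) (hfree hZ b)
      | box a => exact Cocon.box (ih.2.2 σ X Z h hX hZ a)
  | fix η y φ ih =>
    have h1 : ∀ σ : ℕ → Fml, (∀ p, IsFormula (σ p)) → IsFormula (fix η y φ) →
        IsFormula (subst σ (fix η y φ)) := fun σ h hf => by
      rw [subst_fix]
      -- With both sets empty, this is the side condition for the bound variable alone.
      have hZ := hout (φ := φ) (σ := σ) (X := ∅) (Z := ∅) (η := η) (y := y) (by simp)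
      rw [Set.empty_union, Set.empty_union] at hZ
      cases hf with
      | mu a =>
        refine IsFormula.mu (ih.2.1 _ {y} _ (hupd h) ?_ hZ a)
        rintro p rfl _
        rw [Function.update_self]
        exact Con.var rfl
      | nu a =>
        refine IsFormula.nu (ih.2.2 _ {y} _ (hupd h) ?_ hZ a)
        rintro p rfl _
        rw [Function.update_self]
        exact Cocon.var rfl
    refine ⟨h1, fun σ X Z h hX hZ hc => ?_, fun σ X Z h hX hZ hc => ?_⟩
    · cases hc with
      | free a b => exact Con.free (h1 σ h a) (hfree hZ b)
      | mu a =>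
        refine Con.mu (ih.2.1 _ (X ∪ {y}) _ (hupd h) ?_ (hout hZ) a)
        intro p hp hpφ
        by_cases hpy : p = y
        · subst hpy
          rw [Function.update_self]
          exact Con.var (Or.inr rfl)
        · rw [Function.update_of_ne hpy]
          exact (hX p (hp.resolve_right hpy) (Finset.mem_erase.2 ⟨hpy, hpφ⟩)).insert_fresh
            (rebind_notMem hpφ hpy)
    · cases hc with
      | free a b => exact Cocon.free (h1 σ h a) (hfree hZ b)
      | nu a =>
        refine Cocon.nu (ih.2.2 _ (X ∪ {y}) _ (hupd h) ?_ (hout hZ) a)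
        intro p hp hpφ
        by_cases hpy : p = y
        · subst hpy
          rw [Function.update_self]
          exact Cocon.var (Or.inr rfl)
        · rw [Function.update_of_ne hpy]
          exact (hX p (hp.resolve_right hpy) (Finset.mem_erase.2 ⟨hpy, hpφ⟩)).insert_fresh
            (rebind_notMem hpφ hpy)

theorem IsFormula.subst {φ : Fml} {σ : ℕ → Fml} (hσ : ∀ p, IsFormula (σ p)) (h : IsFormula φ) :
    IsFormula (subst σ φ) := (subst_fragments φ).1 σ hσ h

theorem IsFormula.subst1 {φ ψ : Fml} {x : ℕ} (h : IsFormula φ) (hψ : IsFormula ψ) :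
    IsFormula (φ.subst1 x ψ) := by
  refine h.subst fun p => ?_
  by_cases hp : p = x
  · subst hp; simpa using hψ
  · simpa [hp] using IsFormula.var p

/-! ### Valuations that respect the Boolean connectives -/

/-- Two-valued assignments to formulas that respect the Boolean connectives. -/
structure BoolVal (v : Fml → Prop) : Prop where
  neg : ∀ α, v (neg α) ↔ ¬ v α
  or : ∀ α β, v (or α β) ↔ v α ∨ v β
  and : ∀ α β, v (and α β) ↔ v α ∧ v β

namespace BoolVal

variable {v : Fml → Prop}

theorem bot (hv : BoolVal v) : ¬ v bot := by
  have := hv.neg (var 0)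
  rw [Fml.neg] at this
  rw [Fml.bot, hv.and, this]
  tauto

theorem top (hv : BoolVal v) : v top := by
  have := hv.neg (var 0)
  rw [Fml.neg] at this
  rw [Fml.top, hv.or, this]
  tauto

theorem imp (hv : BoolVal v) (α β : Fml) : v (imp α β) ↔ (v α → v β) := by
  rw [Fml.imp, hv.or, hv.neg]
  tauto

theorem iff (hv : BoolVal v) (α β : Fml) : v (iff α β) ↔ (v α ↔ v β) := by
  rw [Fml.iff, hv.and, hv.imp, hv.imp]
  tauto

theorem conjList (hv : BoolVal v) (l : List Fml) : v (conjList l) ↔ ∀ γ ∈ l, v γ := by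
  induction l with
  | nil => simpa [Fml.conjList] using hv.top
  | cons a l ih => simp [Fml.conjList, hv.and, ih]

theorem conj (hv : BoolVal v) (A : Finset Fml) : v (conj A) ↔ ∀ γ ∈ A, v γ := by
  simp [Fml.conj, hv.conjList]

/-- This makes an instance of a formula as easy to evaluate as the formula itself; it depends on
`subst_neg` being an exact equality. -/
theorem comp_subst (hv : BoolVal v) (σ : ℕ → Fml) : BoolVal fun φ => v (subst σ φ) where
  neg α := by rw [subst_neg, hv.neg]
  or α β := hv.or _ _
  and α β := hv.and _ _

end BoolVal

theorem isFormula_conjList {l : List Fml} (h : ∀ γ ∈ l, IsFormula γ) : IsFormula (conjList l) := by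
  induction l with
  | nil => exact isFormula_top
  | cons a l ih =>
    exact IsFormula.and (h a (by simp)) (ih fun γ hγ => h γ (by simp [hγ]))

theorem isFormula_conj {A : Finset Fml} (h : ∀ γ ∈ A, IsFormula γ) : IsFormula (conj A) :=
  isFormula_conjList (by simpa using h)

/-- Disjunction of a list of formulas. -/
def Fml.disjList : List Fml → Fml
  | [] => bot
  | φ :: l => or φ (disjList l)

theorem isFormula_disjList {l : List Fml} (h : ∀ γ ∈ l, IsFormula γ) : IsFormula (disjList l) := by
  induction l with
  | nil => exact isFormula_bot
  | cons a l ih =>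
    exact IsFormula.or (h a (by simp)) (ih fun γ hγ => h γ (by simp [hγ]))

theorem BoolVal.disjList {v : Fml → Prop} (hv : BoolVal v) (l : List Fml) :
    v (disjList l) ↔ ∃ γ ∈ l, v γ := by
  induction l with
  | nil => simpa [Fml.disjList] using hv.bot
  | cons a l ih => simp [Fml.disjList, hv.or, ih]

/-! ### Maximally consistent sets and valuations -/

/-- Moving the premises one by one into an implication leaves a tautology, and modus ponens
discharges them again. -/
theorem IsMucLogic.of_taut {L : Set Fml} (hL : IsMucLogic L) {k : List Fml} (hk : ∀ γ ∈ k, γ ∈ L)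
    {ψ : Fml} (hψ : IsFormula ψ) (h : ∀ v, BoolVal v → (∀ γ ∈ k, v γ) → v ψ) : ψ ∈ L := by
  induction k generalizing ψ with
  | nil => exact hL.tautology ψ hψ fun v h1 h2 h3 => h v ⟨h1, h2, h3⟩ (by simp)
  | cons a k ih =>
    have ha : a ∈ L := hk a (by simp)
    refine hL.modus_ponens a ψ ?_ ha
    refine ih (fun γ hγ => hk γ (by simp [hγ])) (IsFormula.imp (hL.subset_language ha) hψ) ?_
    intro v hv hvk
    rw [hv.imp]
    intro hva
    exact h v hv (by simpa [hva] using hvk)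

theorem IsMucLogic.inconsistent {L Γ : Set Fml} (hL : IsMucLogic L) (hΓ : Γ ⊆ Language)
    {l k : List Fml} (hl : ∀ γ ∈ l, γ ∈ Γ) (hk : ∀ γ ∈ k, γ ∈ L)
    (h : ∀ v, BoolVal v → (∀ γ ∈ k, v γ) → ¬ ∀ γ ∈ l, v γ) : Inconsistent L Γ := by
  refine ⟨l, hl, hL.of_taut hk ?_ fun v hv hvk => ?_⟩
  · exact IsFormula.imp (isFormula_conjList fun γ hγ => hΓ (hl γ hγ)) isFormula_bot
  · rw [hv.imp, hv.conjList]
    exact fun hvl => (h v hv hvk hvl).elim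

/-- Lindenbaum's lemma. -/
theorem exists_maxConsistent {L Γ : Set Fml} (hΓ : Γ ⊆ Language) (hc : Consistent L Γ) :
    ∃ Δ, Γ ⊆ Δ ∧ MaxConsistent L Δ := by
  obtain ⟨Δ, hΓΔ, hΔ⟩ := zorn_subset_nonempty {Δ : Set Fml | Δ ⊆ Language ∧ Consistent L Δ} (by
    intro c hc hchain hne
    refine ⟨⋃₀ c, ⟨Set.sUnion_subset fun s hs => (hc hs).1, ?_⟩, fun s hs =>
      Set.subset_sUnion_of_mem hs⟩
    rintro ⟨l, hl, hlL⟩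
    -- An inconsistency uses only finitely many formulas, and these already lie in one member of the
    -- chain.
    have : ∃ s ∈ c, ∀ γ ∈ l, γ ∈ s := by
      clear hlL
      induction l with
      | nil =>
        obtain ⟨s, hs⟩ := hne
        exact ⟨s, hs, by simp⟩
      | cons a l ih =>
        obtain ⟨s, hs, hsl⟩ := ih fun γ hγ => hl γ (by simp [hγ])
        obtain ⟨t, ht, hat⟩ := hl a (by simp)
        rcases hchain.total hs ht with h | h
        · exact ⟨t, ht, by simpa [hat] using fun γ hγ => h (hsl γ hγ)⟩
        · exact ⟨s, hs, by simpa [h hat] using hsl⟩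
    obtain ⟨s, hs, hsl⟩ := this
    exact (hc hs).2 ⟨l, hsl, hlL⟩) Γ ⟨hΓ, hc⟩
  refine ⟨Δ, hΓΔ, hΔ.prop.1, hΔ.prop.2, fun Γ' hΓ' hlt => ?_⟩
  by_contra h
  exact hlt.2 (hΔ.le_of_ge ⟨hΓ', h⟩ hlt.1)

namespace MaxConsistent

variable {L Γ : Set Fml}

/-- If both `α` and its negation were missing, adding either would be inconsistent. The members of
`Γ` used in the two refutations would then be inconsistent by themselves. -/
theorem neg_mem_of_notMem (hL : IsMucLogic L) (hΓ : MaxConsistent L Γ) {α : Fml}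
    (hα : IsFormula α) (h : α ∉ Γ) : neg α ∈ Γ := by
  by_contra hn
  have hins : ∀ β, IsFormula β → β ∉ Γ →
      ∃ l : List Fml, (∀ γ ∈ l, γ ∈ Γ) ∧ ∃ δ ∈ L, ∀ v, BoolVal v → v δ → (∀ γ ∈ l, v γ) →
        ¬ v β := by
    intro β hβ hβΓ
    obtain ⟨l, hl, hlL⟩ := hΓ.maximal (insert β Γ)
      (Set.insert_subset hβ hΓ.subset_language) (Set.ssubset_insert hβΓ)
    classical
    refine ⟨l.filter (· ≠ β), ?_, _, hlL, ?_⟩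
    · intro γ hγ
      simp only [ne_eq, decide_not, List.mem_filter, Bool.not_eq_true',
        decide_eq_false_iff_not] at hγ
      exact (hl γ hγ.1).resolve_left hγ.2
    · intro v hv hδ hvl hvβ
      rw [hv.imp, hv.conjList] at hδ
      refine hv.bot (hδ fun γ hγ => ?_)
      by_cases hγβ : γ = β
      · rwa [hγβ]
      · exact hvl γ (by simp [hγ, hγβ])
  obtain ⟨l, hl, δ, hδ, hlδ⟩ := hins α hα h
  obtain ⟨k, hk, ε, hε, hkε⟩ := hins _ hα.neg hn
  refine hΓ.consistent (hL.inconsistent hΓ.subset_language (l := l ++ k) (k := [δ, ε]) ?_ ?_ ?_)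
  · simp only [List.mem_append]
    rintro γ (h | h)
    exacts [hl γ h, hk γ h]
  · simp [hδ, hε]
  · intro v hv h1 h2
    refine hkε v hv (h1 _ (by simp)) (fun γ hγ => h2 γ (by simp [hγ])) ?_
    rw [hv.neg]
    exact hlδ v hv (h1 _ (by simp)) (fun γ hγ => h2 γ (by simp [hγ]))

theorem mem_of_taut (hL : IsMucLogic L) (hΓ : MaxConsistent L Γ) {l k : List Fml}
    (hl : ∀ γ ∈ l, γ ∈ Γ) (hk : ∀ γ ∈ k, γ ∈ L) {ψ : Fml} (hψ : IsFormula ψ)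
    (h : ∀ v, BoolVal v → (∀ γ ∈ k, v γ) → (∀ γ ∈ l, v γ) → v ψ) : ψ ∈ Γ := by
  by_contra hn
  have := hΓ.neg_mem_of_notMem hL hψ hn
  refine hΓ.consistent (hL.inconsistent hΓ.subset_language (l := neg ψ :: l) (by simp_all) hk ?_)
  intro v hv h1 h2
  simp only [List.mem_cons, forall_eq_or_imp, hv.neg] at h2
  exact h2.1 (h v hv h1 h2.2)

theorem neg_mem_iff (hL : IsMucLogic L) (hΓ : MaxConsistent L Γ) {α : Fml}
    (hα : IsFormula α) : neg α ∈ Γ ↔ α ∉ Γ := by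
  refine ⟨fun h h' => ?_, hΓ.neg_mem_of_notMem hL hα⟩
  refine hΓ.consistent (hL.inconsistent hΓ.subset_language (l := [α, neg α]) (k := [])
    (by simp [h, h']) (by simp) ?_)
  intro v hv _ h2
  simp [hv.neg] at h2

end MaxConsistent

-- Valuations of a logic

/-- Boolean valuations in which all formulas of the logic `L` are true. -/
structure LogicVal (L : Set Fml) (v : Fml → Prop) : Prop extends BoolVal v where
  mem : ∀ γ ∈ L, v γ

/-- The truth value of a formula relative to a set of formulas `Γ`. -/
def truthIn (Γ : Set Fml) : Fml → Prop
  | .var p => .var p ∈ Γ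
  | .nvar p => .var p ∉ Γ
  | .or φ ψ => truthIn Γ φ ∨ truthIn Γ ψ
  | .and φ ψ => truthIn Γ φ ∧ truthIn Γ ψ
  | .dia φ => .dia φ ∈ Γ
  | .box φ => .dia (neg φ) ∉ Γ
  | .fix .mu x φ => .fix .mu x φ ∈ Γ
  | .fix .nu x φ => neg (.fix .nu x φ) ∉ Γ

/-- Valuations must respect negation on all raw formulas, while a maximally consistent set contains
only genuine ones, so membership itself would not do. Reading `□` and `ν` as negations of `◇` and
`μ` makes the Boolean laws hold for every set `Γ`. -/
theorem boolVal_truthIn (Γ : Set Fml) : BoolVal (truthIn Γ) where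
  neg α := by
    induction α with
    | fix η x φ ih =>
      cases η
      · have := Fml.neg_neg (.fix .mu x φ)
        change neg (neg (.fix .mu x φ)) ∉ Γ ↔ .fix .mu x φ ∉ Γ
        rw [this]
      · rw [Fml.neg, Binder.dual]
        simp [truthIn, Fml.neg, Binder.dual]
    | or φ ψ h1 h2 => simp [Fml.neg, truthIn, h1, h2]
    | and φ ψ h1 h2 => simp only [Fml.neg, truthIn, h1, h2]; tauto
    | _ => simp [Fml.neg, truthIn]
  or _ _ := Iff.rfl
  and _ _ := Iff.rfl

theorem MaxConsistent.truthIn_iff {L Γ : Set Fml} (hL : IsMucLogic L) (hΓ : MaxConsistent L Γ)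
    {α : Fml} (hα : IsFormula α) : truthIn Γ α ↔ α ∈ Γ := by
  induction α with
  | var p => rfl
  | nvar p => exact (hΓ.neg_mem_iff hL (IsFormula.var p)).symm
  | or φ ψ h1 h2 =>
    cases hα with
    | or a b =>
      simp only [truthIn, h1 a, h2 b]
      constructor
      · rintro (h | h)
        · refine hΓ.mem_of_taut hL (l := [φ]) (k := []) (by simp [h]) (by simp) (a.or b) ?_
          intro v hv _ h2
          rw [hv.or]
          exact Or.inl (h2 _ (by simp))
        · refine hΓ.mem_of_taut hL (l := [ψ]) (k := []) (by simp [h]) (by simp) (a.or b) ?_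
          intro v hv _ h2
          rw [hv.or]
          exact Or.inr (h2 _ (by simp))
      · intro h
        by_contra! hn
        refine ((hΓ.neg_mem_iff hL a).2 hn.1 |> fun h1 => hn.2 ?_)
        refine hΓ.mem_of_taut hL (l := [neg φ, or φ ψ]) (k := []) (by simp [h, h1]) (by simp) b ?_
        intro v hv _ h2
        simp only [List.mem_cons, forall_eq_or_imp, hv.neg, hv.or] at h2
        tauto
  | and φ ψ h1 h2 =>
    cases hα with
    | and a b =>
      simp only [truthIn, h1 a, h2 b]
      constructor
      · rintro ⟨h, h'⟩
        refine hΓ.mem_of_taut hL (l := [φ, ψ]) (k := []) (by simp [h, h']) (by simp) (a.and b) ?_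
        intro v hv _ h2
        rw [hv.and]
        exact ⟨h2 _ (by simp), h2 _ (by simp)⟩
      · intro h
        constructor
        · refine hΓ.mem_of_taut hL (l := [and φ ψ]) (k := []) (by simp [h]) (by simp) a ?_
          intro v hv _ h2
          exact ((hv.and φ ψ).1 (h2 _ (by simp))).1
        · refine hΓ.mem_of_taut hL (l := [and φ ψ]) (k := []) (by simp [h]) (by simp) b ?_
          intro v hv _ h2
          exact ((hv.and φ ψ).1 (h2 _ (by simp))).2
  | dia φ ih => rfl
  | box φ ih =>
    rw [truthIn, ← hΓ.neg_mem_iff hL (α := dia (neg φ)), Fml.neg, Fml.neg_neg]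
    cases hα with | box a => exact a.neg.dia
  | fix η x φ ih =>
    cases η
    · rfl
    · rw [truthIn, ← hΓ.neg_mem_iff hL hα.neg, Fml.neg_neg]

theorem MaxConsistent.logicVal {L Γ : Set Fml} (hL : IsMucLogic L) (hΓ : MaxConsistent L Γ) :
    LogicVal L (truthIn Γ) where
  toBoolVal := boolVal_truthIn Γ
  mem γ hγ := by
    have hf := hL.subset_language hγ
    rw [hΓ.truthIn_iff hL hf]
    exact hΓ.mem_of_taut hL (l := []) (k := [γ]) (by simp) (by simpa using hγ) hf
      fun v _ h _ => h γ (by simp)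

theorem LogicVal.maxConsistent {L : Set Fml} {v : Fml → Prop} (hL : IsMucLogic L)
    (hv : LogicVal L v) : MaxConsistent L {α | IsFormula α ∧ v α} where
  subset_language _ h := h.1
  consistent := by
    rintro ⟨l, hl, hlL⟩
    have := hv.mem _ hlL
    rw [hv.imp, hv.conjList] at this
    exact hv.bot (this fun γ hγ => (hl γ hγ).2)
  maximal := by
    intro Γ' hΓ' hlt
    obtain ⟨α, hα, hαv⟩ := Set.exists_of_ssubset hlt
    have hn : neg α ∈ Γ' := hlt.1 ⟨(hΓ' hα).neg, (hv.neg α).2 fun h => hαv ⟨hΓ' hα, h⟩⟩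
    refine hL.inconsistent hΓ' (l := [α, neg α]) (k := []) (by simp [hα, hn]) (by simp) ?_
    intro w hw _ h2
    simp [hw.neg] at h2

/-- A logic is determined by its valuations. -/
theorem IsMucLogic.mem_of_forall_logicVal {L : Set Fml} (hL : IsMucLogic L) {ψ : Fml}
    (hψ : IsFormula ψ) (h : ∀ v, LogicVal L v → v ψ) : ψ ∈ L := by
  by_contra hn
  have hc : Consistent L {neg ψ} := by
    rintro ⟨l, hl, hlL⟩
    refine hn (hL.of_taut (k := [_]) (by simpa using hlL) hψ fun v hv h => ?_)
    simp only [List.mem_singleton, forall_eq, hv.imp, hv.conjList] at h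
    by_contra hvψ
    refine hv.bot (h fun γ hγ => ?_)
    rw [Set.mem_singleton_iff.1 (hl γ hγ), hv.neg]
    exact hvψ
  obtain ⟨Γ, hψΓ, hΓ⟩ := exists_maxConsistent (Set.singleton_subset_iff.2 hψ.neg) hc
  have hv := hΓ.logicVal hL
  have h1 : truthIn Γ (neg ψ) := (hΓ.truthIn_iff hL hψ.neg).2 (hψΓ rfl)
  exact (hv.neg ψ).1 h1 (h _ hv)

/-! ### Derived principles -/

namespace LogicVal

variable {L : Set Fml} {v : Fml → Prop}

theorem dia_mono (hL : IsMucLogic L) (hv : LogicVal L v) {φ ψ : Fml} (hφ : IsFormula φ)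
    (hψ : IsFormula ψ) (h : ∀ w, LogicVal L w → w φ → w ψ) (hd : v (dia φ)) : v (dia ψ) := by
  have h1 : imp φ ψ ∈ L := hL.mem_of_forall_logicVal (hφ.imp hψ) fun w hw => by
    rw [hw.imp]
    exact h w hw
  have h2 := hv.mem _ (hL.monotonicity φ ψ h1)
  rw [hv.imp] at h2
  exact h2 hd

theorem dia_or (hL : IsMucLogic L) (hv : LogicVal L v) {φ ψ : Fml} (hφ : IsFormula φ)
    (hψ : IsFormula ψ) (hd : v (dia (or φ ψ))) : v (dia φ) ∨ v (dia ψ) := by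
  -- Additivity is given for variables and substitution acts on one at a time. First `φ` replaces `q
  -- + 1`; as `q` is not free in `φ`, replacing `q` by `ψ` leaves `φ` alone.
  obtain ⟨q, hq⟩ := Finset.exists_notMem (FV φ)
  have h1 := hL.substitution _ (q + 1) φ (hL.additivity (q + 1) q) hφ
  have h2 := hL.substitution _ q ψ h1 hψ
  have h3 := hv.mem _ h2
  have hb := (hv.toBoolVal.comp_subst (Function.update var q ψ)).comp_subst
    (Function.update var (q + 1) φ)
  have h4 := (hb.iff _ _).1 h3
  have h5 : subst (Function.update var q ψ) φ = φ := subst1_of_notMem hq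
  rw [hb.or] at h4
  simpa [subst, h5, hd] using h4

theorem not_dia_bot (hL : IsMucLogic L) (hv : LogicVal L v) : ¬ v (dia bot) := by
  rw [← hv.neg]
  exact hv.mem _ hL.normality

theorem dia_disjList (hL : IsMucLogic L) (hv : LogicVal L v) {l : List Fml}
    (hl : ∀ γ ∈ l, IsFormula γ) (hd : v (dia (disjList l))) : ∃ γ ∈ l, v (dia γ) := by
  induction l with
  | nil => exact (hv.not_dia_bot hL hd).elim
  | cons a l ih =>
    have hl' : ∀ γ ∈ l, IsFormula γ := fun γ hγ => hl γ (by simp [hγ])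
    rcases hv.dia_or hL (hl a (by simp)) (isFormula_disjList hl') hd with h | h
    · exact ⟨a, by simp, h⟩
    · obtain ⟨γ, hγ, hvγ⟩ := ih hl' h
      exact ⟨γ, by simp [hγ], hvγ⟩

/-- A greatest fixpoint formula implies its unfolding. -/
theorem nu_unfold (hL : IsMucLogic L) (hv : LogicVal L v) {x : ℕ} {φ : Fml} (h : Cocon {x} φ)
    (hd : v (nu x φ)) : v (φ.subst1 x (nu x φ)) := by
  -- The prefixpoint axiom for the dual `μ`-formula, whose contrapositive is the claim.
  have h1 := hv.mem _ (hL.prefixpoint x _ h.negVar_neg)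
  have h2 : mu x (negVar x (neg φ)) = neg (nu x φ) := rfl
  have h3 : (negVar x (neg φ)).subst1 x (neg (nu x φ)) = neg (φ.subst1 x (nu x φ)) := by
    rw [subst1, subst1, ← subst_neg]
    refine subst_negVar_of_eq_neg (by simp) fun p hp => by simp [hp]
  rw [h2, h3, hv.imp, hv.neg, hv.neg] at h1
  tauto

end LogicVal

/-! ### Renaming free variables -/

/-- Variables are renamed one at a time: `hinj` ensures that a step affects only the intended
variable, `hrs` that a variable already renamed is not hit again, and `hr`, `hs` exclude capture.
Two arbitrary renamings allow both shifting and shifting back. -/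
theorem IsMucLogic.rename_mem {L : Set Fml} (hL : IsMucLogic L) {φ : Fml} {r s : ℕ → ℕ}
    (hr : ∀ p ∈ FV φ, ∀ u ∈ BV φ, u ≠ p → u ≠ r p) (hs : ∀ p ∈ FV φ, ∀ u ∈ BV φ, u ≠ p → u ≠ s p)
    (hinj : ∀ p ∈ FV φ, ∀ q ∈ FV φ, r p = r q → p = q)
    (hrs : ∀ p ∈ FV φ, ∀ q ∈ FV φ, s p ≠ r q)
    (h : subst (fun p => var (r p)) φ ∈ L) : subst (fun p => var (s p)) φ ∈ L := by
  have key : ∀ t : Finset ℕ, t ⊆ FV φ →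
      subst (fun p => var (if p ∈ t then s p else r p)) φ ∈ L := by
    intro t
    induction t using Finset.induction_on with
    | empty => simpa using h
    | insert a t hat ih =>
      intro hsub
      obtain ⟨ha, ht⟩ := Finset.insert_subset_iff.1 hsub
      have h1 := hL.substitution _ (r a) (var (s a)) (ih ht) (IsFormula.var _)
      have h2 : ∀ p ∈ FV φ, subst (Function.update var (r a) (var (s a)))
          (var (if p ∈ t then s p else r p)) = var (if p ∈ insert a t then s p else r p) := by
        intro p hp
        simp only [subst]
        by_cases hpt : p ∈ t
        · simp [hpt, hrs p hp a ha]
        · by_cases hpa : p = a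
          · subst hpa; simp [hpt]
          · simp only [hpt, if_false, Finset.mem_insert, hpa, or_self]
            exact Function.update_of_ne (fun e => hpa (hinj p hp a ha e)) _ _
      rw [subst1, subst_subst, subst_congr h2] at h1
      · exact h1
      · intro p hp u hu hup
        simp only [FV, Finset.mem_singleton]
        split_ifs
        exacts [hs p hp u hu hup, hr p hp u hu hup]
      · intro p hp u hu hup
        rw [h2 p hp]
        simp only [FV, Finset.mem_singleton]
        split_ifs
        exacts [hs p hp u hu hup, hr p hp u hu hup]
  have h3 := key _ subset_rfl
  rwa [subst_congr (τ := fun p => var (s p)) fun p hp => by simp [hp]] at h3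

/-- The substitution that adds `N` to every variable. -/
def shift (N p : ℕ) : Fml := var (p + N)

/-- All variables of `φ` are below `N`. -/
def VarsBelow (N : ℕ) (φ : Fml) : Prop := ∀ p ∈ FV φ ∪ BV φ, p < N

theorem IsMucLogic.shift_mem_iff {L : Set Fml} (hL : IsMucLogic L) {φ : Fml} {N : ℕ}
    (h : VarsBelow N φ) : subst (shift N) φ ∈ L ↔ φ ∈ L := by
  have hF : ∀ p ∈ FV φ, p < N := fun p hp => h p (Finset.mem_union_left _ hp)
  have hB : ∀ p ∈ BV φ, p < N := fun p hp => h p (Finset.mem_union_right _ hp)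
  constructor
  · intro h'
    have := hL.rename_mem (r := fun p => p + N) (s := id) (φ := φ)
      (fun p _ u hu _ => by have := hB u hu; omega) (fun p _ u hu hup => hup)
      (fun p _ q _ e => by omega) (fun p hp q hq => by have := hF p hp; simp only [id]; omega) h'
    simpa using this
  · intro h'
    refine hL.rename_mem (r := id) (s := fun p => p + N) (φ := φ)
      (fun p _ u hu hup => hup) (fun p _ u hu _ => by have := hB u hu; omega)
      (fun p _ q _ e => e) (fun p hp q hq => by have := hF q hq; simp only [id]; omega) ?_
    simpa using h'

namespace VarsBelow

variable {N : ℕ} {φ ψ : Fml}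

theorem binary (hφ : VarsBelow N φ) (hψ : VarsBelow N ψ) :
    VarsBelow N (and φ ψ) ∧ VarsBelow N (or φ ψ) := by
  simp only [VarsBelow, FV, BV, Finset.mem_union] at *
  refine ⟨fun p hp => ?_, fun p hp => ?_⟩ <;> rcases hp with (h | h) | (h | h) <;> simp_all

theorem dia (hφ : VarsBelow N φ) : VarsBelow N (dia φ) := hφ

theorem neg (hφ : VarsBelow N φ) : VarsBelow N (neg φ) := by
  have h1 : ∀ (x : ℕ) (φ : Fml), BV (negVar x φ) = BV φ := by
    intro x φ
    induction φ <;> simp only [negVar, BV, *] <;> split_ifs <;> simp [BV, *]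
  have h2 : ∀ φ : Fml, BV (Fml.neg φ) = BV φ := by
    intro φ
    induction φ <;> simp [Fml.neg, BV, *]
  rw [VarsBelow, FV_neg, h2]
  exact hφ

theorem imp (hφ : VarsBelow N φ) (hψ : VarsBelow N ψ) : VarsBelow N (imp φ ψ) :=
  (hφ.neg.binary hψ).2

theorem bot (hN : 0 < N) : VarsBelow N bot := by simp [VarsBelow, Fml.bot, FV, BV, hN]

theorem conj (hN : 0 < N) {A : Finset Fml} (h : ∀ φ ∈ A, VarsBelow N φ) :
    VarsBelow N (conj A) := by
  have : ∀ l : List Fml, (∀ φ ∈ l, VarsBelow N φ) → VarsBelow N (conjList l) := by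
    intro l hl
    induction l with
    | nil => simp [VarsBelow, conjList, Fml.top, FV, BV, hN]
    | cons a l ih =>
      exact ((hl a (by simp)).binary (ih fun φ hφ => hl φ (by simp [hφ]))).1
  exact this _ (by simpa using h)

theorem disjList (hN : 0 < N) {l : List Fml} (hl : ∀ φ ∈ l, VarsBelow N φ) :
    VarsBelow N (disjList l) := by
  induction l with
  | nil => exact bot hN
  | cons a l ih =>
    exact ((hl a (by simp)).binary (ih fun φ hφ => hl φ (by simp [hφ]))).2

end VarsBelow

theorem exists_varsBelow (Sig : Finset Fml) : ∃ N, 0 < N ∧ ∀ φ ∈ Sig, VarsBelow N φ := by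
  -- The bound is positive because `bot` and `top` mention the variable `0`.
  refine ⟨(Sig.biUnion fun φ => FV φ ∪ BV φ).sup id + 1, by omega, fun φ hφ p hp => ?_⟩
  have := Finset.le_sup (f := id) (Finset.mem_biUnion.2 ⟨φ, hφ, hp⟩ :
    p ∈ Sig.biUnion fun φ => FV φ ∪ BV φ)
  simp only [id] at this
  omega

/-! ### States and their shifted descriptions -/

section States

variable {L : Set Fml} {Sig : Finset Fml}

instance : Finite (State L Sig) := by
  have : ∀ A : State L Sig, A.1 ∈ Sig.powerset := by
    rintro ⟨A, Γ, hΓ, hA⟩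
    rw [Finset.mem_powerset, ← Finset.coe_subset, hA]
    exact Set.inter_subset_right
  exact Finite.of_injective (β := Sig.powerset) (fun A => ⟨A.1, this A⟩) fun A B h =>
    Subtype.ext (by simpa using h)

theorem State.subset (A : State L Sig) {α : Fml} (h : α ∈ A.1) : α ∈ Sig := by
  obtain ⟨A, Γ, hΓ, hA⟩ := A
  have : α ∈ (A : Set Fml) := h
  rw [hA] at this
  exact this.2

/-- Every state is the trace of a valuation. -/
theorem State.exists_logicVal (hL : IsMucLogic L) (hform : ∀ φ ∈ Sig, IsFormula φ)
    (A : State L Sig) : ∃ v, LogicVal L v ∧ ∀ α ∈ Sig, α ∈ A.1 ↔ v α := by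
  obtain ⟨A, Γ, hΓ, hA⟩ := A
  refine ⟨truthIn Γ, hΓ.logicVal hL, fun α hα => ?_⟩
  rw [hΓ.truthIn_iff hL (hform α hα), ← Finset.mem_coe, hA]
  simp [hα]

/-- Every valuation traces out a state. -/
theorem LogicVal.exists_state (hL : IsMucLogic L) (hform : ∀ φ ∈ Sig, IsFormula φ)
    {v : Fml → Prop} (hv : LogicVal L v) :
    ∃ A : State L Sig, ∀ α ∈ Sig, α ∈ A.1 ↔ v α := by
  classical
  refine ⟨⟨Sig.filter v, _, hv.maxConsistent hL, ?_⟩, fun α hα => by simp [hα]⟩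
  ext α
  simp only [Finset.coe_filter, Set.mem_ofPred_eq, Set.mem_inter_iff, Finset.mem_coe]
  have := hform α
  tauto

theorem State.isFormula (hform : ∀ φ ∈ Sig, IsFormula φ) (A : State L Sig) :
    IsFormula (conj A.1) := isFormula_conj fun _ hγ => hform _ (A.subset hγ)

/-- Since `Sig` is closed under negation, a state contains each member of `Sig` or its negation, and
so its conjunction decides all of `Sig`. -/
theorem State.mem_iff_of_conj (hL : IsMucLogic L) (hform : ∀ φ ∈ Sig, IsFormula φ)
    (hneg : NegClosed (Sig : Set Fml)) (A : State L Sig) {v : Fml → Prop} (hv : BoolVal v)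
    (h : v (conj A.1)) {α : Fml} (hα : α ∈ Sig) : α ∈ A.1 ↔ v α := by
  rw [hv.conj] at h
  refine ⟨h α, fun hvα => ?_⟩
  by_contra hn
  obtain ⟨w, hw, hA⟩ := A.exists_logicVal hL hform
  rw [hA α hα, ← hw.neg, ← hA _ (hneg α hα)] at hn
  exact (hv.neg α).1 (h _ hn) hvα

/-- The conjunction of a state, with all free variables shifted by `N`. -/
noncomputable def State.descr (N : ℕ) (A : State L Sig) : Fml := subst (shift N) (conj A.1)

/-- The disjunction of the descriptions of the states in `W`. -/
noncomputable def descrSet (N : ℕ) (W : Set (State L Sig)) : Fml :=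
  subst (shift N) (disjList ((Set.toFinite W).toFinset.toList.map fun A => conj A.1))

theorem State.isFormula_descr (hform : ∀ φ ∈ Sig, IsFormula φ) (N : ℕ) (A : State L Sig) :
    IsFormula (A.descr N) := (A.isFormula hform).subst fun _ => IsFormula.var _

theorem isFormula_descrSet (hform : ∀ φ ∈ Sig, IsFormula φ) (N : ℕ) (W : Set (State L Sig)) :
    IsFormula (descrSet N W) := by
  refine (isFormula_disjList fun γ hγ => ?_).subst fun _ => IsFormula.var _
  obtain ⟨A, -, rfl⟩ := List.mem_map.1 hγ
  exact A.isFormula hform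

theorem BoolVal.descrSet {v : Fml → Prop} (hv : BoolVal v) (N : ℕ) (W : Set (State L Sig)) :
    v (descrSet N W) ↔ ∃ A ∈ W, v (A.descr N) := by
  refine ((hv.comp_subst (shift N)).disjList _).trans ?_
  simp [State.descr]

theorem notMem_FV_shift {N u : ℕ} (hu : u < N) (φ : Fml) : u ∉ FV (subst (shift N) φ) := by
  rw [mem_FV_subst]
  rintro ⟨p, -, hp⟩
  simp only [shift, FV, Finset.mem_singleton] at hp
  omega

theorem State.mem_iff_of_descr (hL : IsMucLogic L) (hform : ∀ φ ∈ Sig, IsFormula φ)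
    (hneg : NegClosed (Sig : Set Fml)) {N : ℕ} (A : State L Sig) {v : Fml → Prop}
    (hv : BoolVal v) (h : v (A.descr N)) {α : Fml} (hα : α ∈ Sig) :
    α ∈ A.1 ↔ v (subst (shift N) α) :=
  A.mem_iff_of_conj hL hform hneg (hv.comp_subst (shift N)) h hα

theorem State.eq_of_descr (hL : IsMucLogic L) (hform : ∀ φ ∈ Sig, IsFormula φ)
    (hneg : NegClosed (Sig : Set Fml)) {N : ℕ} {A B : State L Sig} {v : Fml → Prop}
    (hv : BoolVal v) (hA : v (A.descr N)) (hB : v (B.descr N)) : A = B := by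
  refine Subtype.ext (Finset.ext fun α => ?_)
  by_cases hα : α ∈ Sig
  · rw [A.mem_iff_of_descr hL hform hneg hv hA hα, B.mem_iff_of_descr hL hform hneg hv hB hα]
  · exact ⟨fun h => (hα (A.subset h)).elim, fun h => (hα (B.subset h)).elim⟩

theorem State.varsBelow {N : ℕ} (hN : 0 < N) (hSig : ∀ φ ∈ Sig, VarsBelow N φ)
    (A : State L Sig) : VarsBelow N (conj A.1) :=
  VarsBelow.conj hN fun _ hφ => hSig _ (A.subset hφ)

/-- The disjunction of all state conjunctions is a theorem, since every valuation traces out a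
state. The shift carries this theorem over to descriptions. -/
theorem LogicVal.exists_descr (hL : IsMucLogic L) (hform : ∀ φ ∈ Sig, IsFormula φ)
    {N : ℕ} (hN : 0 < N) (hSig : ∀ φ ∈ Sig, VarsBelow N φ) {v : Fml → Prop}
    (hv : LogicVal L v) : ∃ A : State L Sig, v (A.descr N) := by
  have h : disjList ((Set.toFinite (Set.univ : Set (State L Sig))).toFinset.toList.map
      fun A => conj A.1) ∈ L := by
    refine hL.mem_of_forall_logicVal (isFormula_disjList fun γ hγ => ?_) fun w hw => ?_
    · obtain ⟨A, -, rfl⟩ := List.mem_map.1 hγ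
      exact A.isFormula hform
    · obtain ⟨A, hA⟩ := hw.exists_state hL hform
      rw [hw.disjList]
      refine ⟨conj A.1, List.mem_map.2 ⟨A, by simp, rfl⟩, ?_⟩
      rw [hw.conj]
      exact fun γ hγ => (hA γ (A.subset hγ)).1 hγ
  rw [← hL.shift_mem_iff (N := N)] at h
  · have := hv.mem _ h
    obtain ⟨A, -, hA⟩ := (hv.descrSet N Set.univ).1 this
    exact ⟨A, hA⟩
  · refine VarsBelow.disjList hN fun φ hφ => ?_
    obtain ⟨A, -, rfl⟩ := List.mem_map.1 hφ
    exact A.varsBelow hN hSig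

theorem State.exists_logicVal_descr (hL : IsMucLogic L) (hform : ∀ φ ∈ Sig, IsFormula φ)
    {N : ℕ} (hN : 0 < N) (hSig : ∀ φ ∈ Sig, VarsBelow N φ) (A : State L Sig) :
    ∃ v, LogicVal L v ∧ v (A.descr N) := by
  by_contra! h
  have hf : IsFormula (imp (conj A.1) bot) := (A.isFormula hform).imp isFormula_bot
  have h1 : subst (shift N) (imp (conj A.1) bot) ∈ L :=
    hL.mem_of_forall_logicVal (hf.subst fun _ => IsFormula.var _) fun v hv =>
      ((hv.comp_subst (shift N)).imp _ _).2 fun hA => (h v hv hA).elim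
  rw [hL.shift_mem_iff ((A.varsBelow hN hSig).imp (VarsBelow.bot hN))] at h1
  obtain ⟨v, hv, hA⟩ := A.exists_logicVal hL hform
  have h2 := hv.mem _ h1
  rw [hv.imp, hv.conj] at h2
  exact hv.bot (h2 fun γ hγ => (hA γ (A.subset hγ)).1 hγ)

/-- If `L` refuted the conjunction defining `Rmin`, it would also refute its shift, which `v` makes
true. -/
theorem LogicVal.rmin_of_descr (hL : IsMucLogic L) (hform : ∀ φ ∈ Sig, IsFormula φ)
    {N : ℕ} (hN : 0 < N) (hSig : ∀ φ ∈ Sig, VarsBelow N φ) {v : Fml → Prop}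
    (hv : LogicVal L v) {A B : State L Sig} (hA : v (A.descr N)) (hB : v (dia (B.descr N))) :
    Rmin L Sig A B := by
  rintro ⟨l, hl, hlL⟩
  have h1 : imp (and (conj A.1) (dia (conj B.1))) bot ∈ L := by
    refine hL.mem_of_forall_logicVal
      (((A.isFormula hform).and (B.isFormula hform).dia).imp isFormula_bot) fun w hw => ?_
    have h := hw.mem _ hlL
    rw [hw.imp, hw.conjList] at h
    rw [hw.imp]
    intro hAB
    refine h fun γ hγ => ?_
    rwa [Set.mem_singleton_iff.1 (hl γ hγ)]
  rw [← hL.shift_mem_iff (((A.varsBelow hN hSig).binary (B.varsBelow hN hSig).dia).1.imp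
    (VarsBelow.bot hN))] at h1
  have hb := hv.toBoolVal.comp_subst (shift N)
  have h2 := (hb.imp _ _).1 (hv.mem _ h1)
  exact hb.bot (h2 ((hb.and _ _).2 ⟨hA, hB⟩))

theorem LogicVal.dia_descrSet (hL : IsMucLogic L) (hform : ∀ φ ∈ Sig, IsFormula φ) {N : ℕ}
    {v : Fml → Prop} (hv : LogicVal L v) {W : Set (State L Sig)} (h : v (dia (descrSet N W))) :
    ∃ A ∈ W, v (dia (A.descr N)) := by
  have hl : ∀ γ ∈ (Set.toFinite W).toFinset.toList.map fun A => A.descr N, IsFormula γ := by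
    intro γ hγ
    obtain ⟨A, -, rfl⟩ := List.mem_map.1 hγ
    exact A.isFormula_descr hform N
  have h1 := hv.dia_mono hL (isFormula_descrSet hform N W) (isFormula_disjList hl) (by
    intro w hw h
    rw [hw.descrSet] at h
    simpa [hw.disjList] using h) h
  simpa using hv.dia_disjList hL hl h1

/-- A diamond that is compatible with a state is witnessed by a successor of that state. -/
theorem LogicVal.exists_successor (hL : IsMucLogic L) (hform : ∀ φ ∈ Sig, IsFormula φ)
    {N : ℕ} (hN : 0 < N) (hSig : ∀ φ ∈ Sig, VarsBelow N φ) {M : Model (State L Sig)}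
    (hM : IsModelOver L Sig M) {v : Fml → Prop} (hv : LogicVal L v) {A : State L Sig}
    (hA : v (A.descr N)) {φ : Fml} (hφ : IsFormula φ) (h : v (dia φ)) :
    ∃ B, M.R A B ∧ ∃ w, LogicVal L w ∧ w (B.descr N) ∧ w φ := by
  -- Otherwise `φ` implies the disjunction of the descriptions of non-successors of `A`. The diamond
  -- then distributes to one of them, and the lower bound on `R` makes that state a successor.
  by_contra! hn
  obtain ⟨B, hB, hvB⟩ := hv.dia_descrSet hL hform (W := {B | ¬ M.R A B}) (N := N)
    (hv.dia_mono hL hφ (isFormula_descrSet hform _ _) (fun w hw hwφ => by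
      obtain ⟨B, hB⟩ := hw.exists_descr hL hform hN hSig
      exact (hw.descrSet _ _).2 ⟨B, fun hAB => hn B hAB w hw hB hwφ, hB⟩) h)
  exact hB (hM.rmin_le _ _ (hv.rmin_of_descr hL hform hN hSig hA hvB))

end States

/-! ### The truth lemma -/

section Truth

variable {L : Set Fml} {Sig : Finset Fml} {M K : Model (State L Sig)} {B : Finset ℕ}
  {σ : ℕ → Fml} {X : Set ℕ} {φ : Fml} {N : ℕ}

/-- The substitution `σ` and the model `K` provide compatible readings of the free variables of
`φ`, except possibly for those in `X`, and `σ` does not interfere with the bound variables `B`. -/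
structure Compat (M : Model (State L Sig)) (B : Finset ℕ) (σ : ℕ → Fml) (K : Model (State L Sig))
    (X : Set ℕ) (φ : Fml) : Prop where
  rel : K.R = M.R
  pos : ∀ p ∈ FV φ, p ∉ X → ∀ A : State L Sig, σ p ∈ A.1 → A ∈ K.V p
  negLit : ∀ p ∈ negLits φ, σ p = var p ∧ K.V p = M.V p
  fresh : ∀ p ∈ FV φ, ∀ u ∈ B, u ∉ FV (σ p)
  isFormula : ∀ p, IsFormula (σ p)

theorem Compat.mono {ψ : Fml} {Y : Set ℕ} (h : Compat M B σ K X φ) (hF : FV ψ ⊆ FV φ)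
    (hn : negLits ψ ⊆ negLits φ) (hXY : ∀ p ∈ FV ψ, p ∈ X → p ∈ Y) : Compat M B σ K Y ψ where
  rel := h.rel
  pos p hp hpY := h.pos p (hF hp) fun hX => hpY (hXY p hp hX)
  negLit p hp := h.negLit p (hn hp)
  fresh p hp := h.fresh p (hF hp)
  isFormula := h.isFormula

/-- Compatibility passes to the body of a fixpoint formula, whose binder is read as the
fixpoint formula and as a set `Z` of states. -/
theorem Compat.fix {η : Binder} {y : ℕ} {Y : Set ℕ} {Z : Set (State L Sig)}
    (h : Compat M B σ K X (fix η y φ)) (hy : y ∉ negLits φ)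
    (hφ : IsFormula (Fml.fix η y φ)) (hXY : ∀ p, p ≠ y → p ∉ Y → p ∉ X)
    (hZ : y ∉ Y → ∀ A : State L Sig, subst σ (Fml.fix η y φ) ∈ A.1 → A ∈ Z) :
    Compat M B (Function.update σ y (subst σ (Fml.fix η y φ))) (K.update y Z) Y φ where
  rel := h.rel
  pos p hp hpY := by
    by_cases hpy : p = y
    · subst hpy
      simpa [Model.update] using hZ hpY
    · simpa [Model.update, hpy] using
        h.pos p (Finset.mem_erase.2 ⟨hpy, hp⟩) (hXY p hpy hpY)
  negLit p hp := by
    have hpy : p ≠ y := fun e => hy (e ▸ hp)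
    simpa [Model.update, hpy] using h.negLit p (Finset.mem_erase.2 ⟨hpy, hp⟩)
  fresh p hp u hu := by
    by_cases hpy : p = y
    · subst hpy
      rw [Function.update_self, mem_FV_subst]
      rintro ⟨q, hq, huq⟩
      exact h.fresh q hq u hu huq
    · rw [Function.update_of_ne hpy]
      exact h.fresh p (Finset.mem_erase.2 ⟨hpy, hp⟩) u hu
  isFormula p := by
    by_cases hpy : p = y
    · subst hpy
      rw [Function.update_self]
      exact hφ.subst h.isFormula
    · simpa [hpy] using h.isFormula p

theorem Compat.subst_fix {η : Binder} {y : ℕ} (h : Compat M B σ K X (Fml.fix η y φ))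
    (hB : BV (Fml.fix η y φ) ⊆ B) :
    subst σ (Fml.fix η y φ) = Fml.fix η y (subst (Function.update σ y (var y)) φ) :=
  subst_fix_of_noCapture fun p hp hpy =>
    h.fresh p (Finset.mem_erase.2 ⟨hpy, hp⟩) y (hB (by simp [BV]))

/-- The unfolding of an instance of a fixpoint formula is an instance of its body. -/
theorem Compat.unfold {η : Binder} {y : ℕ} (h : Compat M B σ K X (Fml.fix η y φ))
    (hB : BV (Fml.fix η y φ) ⊆ B) :
    (subst (Function.update σ y (var y)) φ).subst1 y (subst σ (Fml.fix η y φ)) =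
      subst (Function.update σ y (subst σ (Fml.fix η y φ))) φ := by
  have hB' : BV φ ⊆ B := (Finset.subset_insert _ _).trans hB
  refine subst1_subst_update (fun p hp hpy => ?_) fun u hu hu' => ?_
  · have := h.fresh p (Finset.mem_erase.2 ⟨hpy, hp⟩)
    exact ⟨this y (hB (by simp [BV])), fun u hu => this u (hB' hu)⟩
  · obtain ⟨p, hp, hup⟩ := mem_FV_subst.1 hu'
    exact h.fresh p hp u (hB' hu) hup

theorem Compat.unfold_mem {η : Binder} {y : ℕ} (h : Compat M B σ K X (Fml.fix η y φ))
    (hB : BV (Fml.fix η y φ) ⊆ B) (hFL : FLClosed (Sig : Set Fml))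
    (hmem : subst σ (Fml.fix η y φ) ∈ Sig) :
    subst (Function.update σ y (subst σ (Fml.fix η y φ))) φ ∈ Sig := by
  rw [← h.unfold hB]
  have h1 : FLClosure (Sig : Set Fml) (subst σ (Fml.fix η y φ)) := FLClosure.base hmem
  have h2 := h.subst_fix hB
  rw [h2] at h1 ⊢
  exact hFL.subset h1.unfold

open Classical in
/-- Read the variables in `X` as descriptions of sets of states, and all others as shifted
instances of `σ`. -/
noncomputable def descrSubst (N : ℕ) (X : Set ℕ) (σ : ℕ → Fml) (K : Model (State L Sig)) (p : ℕ) :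
    Fml :=
  if p ∈ X then descrSet N (K.V p) else subst (shift N) (σ p)

theorem notMem_FV_descrSubst {u : ℕ} (hu : u < N) (p : ℕ) :
    u ∉ FV (descrSubst N X σ K p) := by
  unfold descrSubst
  split_ifs
  exacts [notMem_FV_shift hu _, notMem_FV_shift hu _]

theorem isFormula_descrSubst (hform : ∀ φ ∈ Sig, IsFormula φ) (hσ : ∀ p, IsFormula (σ p)) (p : ℕ) :
    IsFormula (descrSubst N X σ K p) := by
  unfold descrSubst
  split_ifs
  exacts [isFormula_descrSet hform _ _, (hσ p).subst fun _ => IsFormula.var _]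

/-- The formula `θ` disappears because `y` is now read as a set of states. -/
theorem descrSubst_update {y : ℕ} {θ : Fml} {Z : Set (State L Sig)} :
    descrSubst N (X ∪ {y}) (Function.update σ y θ) (K.update y Z) =
      Function.update (descrSubst N X σ K) y (descrSet N Z) := by
  funext p
  by_cases hpy : p = y
  · subst hpy
    simp [descrSubst, Model.update]
  · simp only [descrSubst, Model.update, Function.update_of_ne hpy]
    by_cases hX : p ∈ X
    · rw [if_pos hX, if_pos (show p ∈ X ∪ {y} from Or.inl hX)]
    · rw [if_neg hX, if_neg (show p ∉ X ∪ {y} by simp [hX, hpy])]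

/-- When no variable of `X` is free, the reading by descriptions is a shifted instance, so the state
decides it by membership. -/
theorem Compat.subst_descrSubst (h : Compat M B σ K X φ) (hB : BV φ ⊆ B) (hN : ∀ u ∈ B, u < N)
    (hX : ∀ x ∈ X, x ∉ FV φ) :
    subst (descrSubst N X σ K) φ = subst (shift N) (subst σ φ) := by
  rw [subst_subst (fun p hp u hu _ => h.fresh p hp u (hB hu))
    fun p _ u hu _ => notMem_FV_shift (hN u (hB hu)) _]
  exact subst_congr fun p hp => if_neg fun hpX => hX p hpX hp

/-- The least fixpoint case: if instances of the body are true, then so are instances of the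
fixpoint formula. -/
theorem mem_meaning_mu (hL : IsMucLogic L) (hform : ∀ φ ∈ Sig, IsFormula φ)
    (hneg : NegClosed (Sig : Set Fml)) (hFL : FLClosed (Sig : Set Fml))
    (hN0 : 0 < N) (hSig : ∀ φ ∈ Sig, VarsBelow N φ) (hN : ∀ u ∈ B, u < N) {y : ℕ}
    (ih : ∀ X σ (K : Model (State L Sig)), Compat M B σ K X φ → Con X φ → subst σ φ ∈ Sig →
      ∀ v, LogicVal L v → ∀ A : State L Sig, v (A.descr N) → v (subst (descrSubst N X σ K) φ) →
        A ∈ meaning φ K)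
    (h : Compat M B σ K X (mu y φ)) (hB : BV (mu y φ) ⊆ B) (hcon : Con (X ∪ {y}) φ)
    (hmem : subst σ (mu y φ) ∈ Sig) {v : Fml → Prop} (hv : LogicVal L v) {A : State L Sig}
    (hA : v (A.descr N)) (hvφ : v (subst (descrSubst N X σ K) (mu y φ))) :
    A ∈ meaning (mu y φ) K := by
  have hB' : BV φ ⊆ B := (Finset.subset_insert _ _).trans hB
  have hy : y < N := hN y (hB (by simp [BV]))
  have hcony : Con {y} φ := hcon.antitone Set.subset_union_right
  rw [meaning, Set.mem_sInter]
  -- It suffices to treat an arbitrary prefixpoint `Z`, described by the formula `descrSet N Z`.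
  intro Z hZ
  rw [subst_fix_of_noCapture fun p _ _ => notMem_FV_descrSubst hy p] at hvφ
  set ψ := subst (Function.update (descrSubst N X σ K) y (var y)) φ with hψ
  have hunf : ψ.subst1 y (descrSet N Z) =
      subst (Function.update (descrSubst N X σ K) y (descrSet N Z)) φ :=
    subst1_subst_update
      (fun p _ _ => ⟨notMem_FV_descrSubst hy p, fun u hu => notMem_FV_descrSubst (hN u (hB' hu)) p⟩)
      fun u hu => notMem_FV_shift (hN u (hB' hu)) _
  have hconψ : Con {y} ψ := by
    refine (subst_fragments φ).2.1 _ {y} {y} (fun p => ?_) ?_ ?_ hcony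
    · by_cases hpy : p = y
      · subst hpy
        simpa using IsFormula.var p
      · simpa [hpy] using isFormula_descrSubst hform h.isFormula p
    · rintro p rfl _
      rw [Function.update_self]
      exact Con.var rfl
    · rintro p _ hpy z rfl
      rw [Function.update_of_ne hpy]
      exact notMem_FV_descrSubst hy p
  have hprefix : imp (ψ.subst1 y (descrSet N Z)) (descrSet N Z) ∈ L := by
    have hZf := isFormula_descrSet hform N Z
    refine hL.mem_of_forall_logicVal ((hconψ.isFormula.subst1 hZf).imp hZf) fun w hw => ?_
    rw [hw.imp, hunf, hw.descrSet]
    intro hwφ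
    obtain ⟨C, hC⟩ := hw.exists_descr hL hform hN0 hSig
    -- The induction hypothesis reads `y` as `Z`. No condition links `Z` to the formula substituted
    -- for `y`, since `y` belongs to `X ∪ {y}`.
    refine ⟨C, hZ (ih (X ∪ {y}) _ _ (h.fix (Z := Z) (hcony.notMem_negLits rfl)
      (IsFormula.mu hcony) (fun p _ hp hpX => hp (Or.inl hpX)) fun hy => (hy (Or.inr rfl)).elim)
      hcon (h.unfold_mem hB hFL hmem) w hw C hC ?_), hC⟩
    rwa [descrSubst_update]
  have hle := hv.mem _ (hL.least_prefixpoint y ψ _ hconψ (isFormula_descrSet hform N Z) hprefix)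
  rw [hv.imp, hv.descrSet] at hle
  obtain ⟨C, hCZ, hC⟩ := hle hvφ
  rwa [State.eq_of_descr hL hform hneg hv.toBoolVal hA hC]

/-- Instances of `φ` in a state are true at that state and, for continuous `φ`, so are
instances of `φ` compatible with the state whose variables stand for sets of states. -/
theorem mem_meaning_of_compat (hL : IsMucLogic L) (hform : ∀ φ ∈ Sig, IsFormula φ)
    (hneg : NegClosed (Sig : Set Fml)) (hFL : FLClosed (Sig : Set Fml)) (hM : IsModelOver L Sig M)
    (hN0 : 0 < N) (hSig : ∀ φ ∈ Sig, VarsBelow N φ) (hN : ∀ u ∈ B, u < N)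
    (hφ : IsFormula φ) (hB : BV φ ⊆ B) :
    (∀ σ (K : Model (State L Sig)), Compat M B σ K ∅ φ → subst σ φ ∈ Sig →
      ∀ A : State L Sig, subst σ φ ∈ A.1 → A ∈ meaning φ K) ∧
    (∀ X σ (K : Model (State L Sig)), Compat M B σ K X φ → Con X φ → subst σ φ ∈ Sig →
      ∀ v, LogicVal L v → ∀ A : State L Sig, v (A.descr N) → v (subst (descrSubst N X σ K) φ) →
        A ∈ meaning φ K) := by
  -- When the variables of `X` are not free in `φ`, the second claim reduces to the first.
  have hfree : ∀ φ, (∀ σ (K : Model (State L Sig)), Compat M B σ K ∅ φ → subst σ φ ∈ Sig →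
      ∀ A : State L Sig, subst σ φ ∈ A.1 → A ∈ meaning φ K) → BV φ ⊆ B →
      ∀ X σ (K : Model (State L Sig)), Compat M B σ K X φ → (∀ x ∈ X, x ∉ FV φ) →
      subst σ φ ∈ Sig →
      ∀ v, LogicVal L v → ∀ A : State L Sig, v (A.descr N) → v (subst (descrSubst N X σ K) φ) →
        A ∈ meaning φ K := by
    intro φ ht hB X σ K h hX hmem v hv A hA hvφ
    rw [h.subst_descrSubst hB hN hX, ← A.mem_iff_of_descr hL hform hneg hv.toBoolVal hA hmem]
      at hvφ
    exact ht σ K (h.mono subset_rfl subset_rfl fun p hp hpX => (hX p hpX hp).elim) hmem A hvφ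
  induction φ with
  | var p =>
    have ht : ∀ σ (K : Model (State L Sig)), Compat M B σ K ∅ (var p) → subst σ (var p) ∈ Sig →
        ∀ A : State L Sig, subst σ (var p) ∈ A.1 → A ∈ meaning (var p) K :=
      fun σ K h _ A hA => h.pos p (by simp [FV]) (Set.notMem_empty p) A hA
    refine ⟨ht, fun X σ K h hcon hmem v hv A hA hvφ => ?_⟩
    cases hcon with
    | free _ hX => exact hfree _ ht hB X σ K h hX hmem v hv A hA hvφ
    | var hp =>
      rw [subst, descrSubst, if_pos hp, hv.descrSet] at hvφ
      obtain ⟨C, hC, hvC⟩ := hvφ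
      rwa [State.eq_of_descr hL hform hneg hv.toBoolVal hA hvC]
  | nvar p =>
    have ht : ∀ σ (K : Model (State L Sig)), Compat M B σ K ∅ (nvar p) → subst σ (nvar p) ∈ Sig →
        ∀ A : State L Sig, subst σ (nvar p) ∈ A.1 → A ∈ meaning (nvar p) K := by
      intro σ K h hmem A hA
      obtain ⟨hσ, hV⟩ := h.negLit p (by simp [negLits])
      rw [subst, hσ] at hmem hA
      -- Closure of `Sig` makes the valuation at `p` known; compatibility has left `p` untouched in
      -- both `σ` and `K`.
      have hp : var p ∈ Sig := hFL.subset (FLClosure.nvar (FLClosure.base hmem))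
      obtain ⟨v, hv, hvA⟩ := A.exists_logicVal hL hform
      rw [hvA _ hmem, hv.neg, ← hvA _ hp] at hA
      rw [meaning, hV, hM.valuation p hp]
      exact hA
    refine ⟨ht, fun X σ K h hcon hmem v hv A hA hvφ => ?_⟩
    cases hcon with | free _ hX => exact hfree _ ht hB X σ K h hX hmem v hv A hA hvφ
  | or φ ψ ih1 ih2 =>
    obtain ⟨hf1, hf2⟩ : IsFormula φ ∧ IsFormula ψ := by cases hφ with | or a b => exact ⟨a, b⟩
    obtain ⟨hB1, hB2⟩ := Finset.union_subset_iff.1 hB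
    have hc1 : ∀ {X σ} {K : Model (State L Sig)}, Compat M B σ K X (or φ ψ) →
        Compat M B σ K X φ := fun h =>
      h.mono Finset.subset_union_left Finset.subset_union_left fun _ _ h => h
    have hc2 : ∀ {X σ} {K : Model (State L Sig)}, Compat M B σ K X (or φ ψ) →
        Compat M B σ K X ψ := fun h =>
      h.mono Finset.subset_union_right Finset.subset_union_right fun _ _ h => h
    have hm1 : ∀ {σ}, subst σ (or φ ψ) ∈ Sig → subst σ φ ∈ Sig := fun h =>
      hFL.subset (FLClosure.or_left (FLClosure.base h))
    have hm2 : ∀ {σ}, subst σ (or φ ψ) ∈ Sig → subst σ ψ ∈ Sig := fun h =>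
      hFL.subset (FLClosure.or_right (FLClosure.base h))
    have ht : ∀ σ (K : Model (State L Sig)), Compat M B σ K ∅ (or φ ψ) →
        subst σ (or φ ψ) ∈ Sig → ∀ A : State L Sig, subst σ (or φ ψ) ∈ A.1 →
        A ∈ meaning (or φ ψ) K := by
      intro σ K h hmem A hA
      obtain ⟨v, hv, hvA⟩ := A.exists_logicVal hL hform
      rw [hvA _ hmem, subst, hv.or, ← hvA _ (hm1 hmem), ← hvA _ (hm2 hmem)] at hA
      exact hA.imp ((ih1 hf1 hB1).1 σ K (hc1 h) (hm1 hmem) A)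
        ((ih2 hf2 hB2).1 σ K (hc2 h) (hm2 hmem) A)
    refine ⟨ht, fun X σ K h hcon hmem v hv A hA hvφ => ?_⟩
    cases hcon with
    | free _ hX => exact hfree _ ht hB X σ K h hX hmem v hv A hA hvφ
    | or a b =>
      rw [subst, hv.or] at hvφ
      exact hvφ.imp ((ih1 hf1 hB1).2 X σ K (hc1 h) a (hm1 hmem) v hv A hA)
        ((ih2 hf2 hB2).2 X σ K (hc2 h) b (hm2 hmem) v hv A hA)
  | and φ ψ ih1 ih2 =>
    obtain ⟨hf1, hf2⟩ : IsFormula φ ∧ IsFormula ψ := by cases hφ with | and a b => exact ⟨a, b⟩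
    obtain ⟨hB1, hB2⟩ := Finset.union_subset_iff.1 hB
    have hc1 : ∀ {X σ} {K : Model (State L Sig)}, Compat M B σ K X (and φ ψ) →
        Compat M B σ K X φ := fun h =>
      h.mono Finset.subset_union_left Finset.subset_union_left fun _ _ h => h
    have hc2 : ∀ {X σ} {K : Model (State L Sig)}, Compat M B σ K X (and φ ψ) →
        Compat M B σ K X ψ := fun h =>
      h.mono Finset.subset_union_right Finset.subset_union_right fun _ _ h => h
    have hm1 : ∀ {σ}, subst σ (and φ ψ) ∈ Sig → subst σ φ ∈ Sig := fun h =>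
      hFL.subset (FLClosure.and_left (FLClosure.base h))
    have hm2 : ∀ {σ}, subst σ (and φ ψ) ∈ Sig → subst σ ψ ∈ Sig := fun h =>
      hFL.subset (FLClosure.and_right (FLClosure.base h))
    have ht : ∀ σ (K : Model (State L Sig)), Compat M B σ K ∅ (and φ ψ) →
        subst σ (and φ ψ) ∈ Sig → ∀ A : State L Sig, subst σ (and φ ψ) ∈ A.1 →
        A ∈ meaning (and φ ψ) K := by
      intro σ K h hmem A hA
      obtain ⟨v, hv, hvA⟩ := A.exists_logicVal hL hform
      rw [hvA _ hmem, subst, hv.and, ← hvA _ (hm1 hmem), ← hvA _ (hm2 hmem)] at hA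
      exact hA.imp ((ih1 hf1 hB1).1 σ K (hc1 h) (hm1 hmem) A)
        ((ih2 hf2 hB2).1 σ K (hc2 h) (hm2 hmem) A)
    refine ⟨ht, fun X σ K h hcon hmem v hv A hA hvφ => ?_⟩
    cases hcon with
    | free _ hX => exact hfree _ ht hB X σ K h hX hmem v hv A hA hvφ
    | and a b =>
      rw [subst, hv.and] at hvφ
      exact hvφ.imp ((ih1 hf1 hB1).2 X σ K (hc1 h) a (hm1 hmem) v hv A hA)
        ((ih2 hf2 hB2).2 X σ K (hc2 h) b (hm2 hmem) v hv A hA)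
  | dia φ ih =>
    have hf : IsFormula φ := by cases hφ with | dia a => exact a
    have hc : ∀ {X σ} {K : Model (State L Sig)}, Compat M B σ K X (dia φ) →
        Compat M B σ K X φ := fun h => h.mono subset_rfl subset_rfl fun _ _ h => h
    have hm : ∀ {σ}, subst σ (dia φ) ∈ Sig → subst σ φ ∈ Sig := fun h =>
      hFL.subset (FLClosure.dia (FLClosure.base h))
    have ht : ∀ σ (K : Model (State L Sig)), Compat M B σ K ∅ (dia φ) →
        subst σ (dia φ) ∈ Sig → ∀ A : State L Sig, subst σ (dia φ) ∈ A.1 →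
        A ∈ meaning (dia φ) K := by
      intro σ K h hmem A hA
      obtain ⟨v, hv, hvA⟩ := A.exists_logicVal_descr hL hform hN0 hSig
      rw [A.mem_iff_of_descr hL hform hneg hv.toBoolVal hvA hmem] at hA
      obtain ⟨C, hAC, w, hw, hwC, hwφ⟩ := hv.exists_successor hL hform hN0 hSig hM hvA
        (φ := subst (shift N) (subst σ φ))
        ((hf.subst h.isFormula).subst fun _ => IsFormula.var _) hA
      rw [← C.mem_iff_of_descr hL hform hneg hw.toBoolVal hwC (hm hmem)] at hwφ
      exact ⟨C, h.rel ▸ hAC, (ih hf hB).1 σ K (hc h) (hm hmem) C hwφ⟩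
    refine ⟨ht, fun X σ K h hcon hmem v hv A hA hvφ => ?_⟩
    cases hcon with
    | free _ hX => exact hfree _ ht hB X σ K h hX hmem v hv A hA hvφ
    | dia a =>
      -- The formula under the diamond need not be in `Sig`; the successor carries a valuation `w`
      -- making it true together with the description of `C`.
      obtain ⟨C, hAC, w, hw, hwC, hwφ⟩ := hv.exists_successor hL hform hN0 hSig hM hA
        (hf.subst fun p => isFormula_descrSubst hform h.isFormula p) hvφ
      exact ⟨C, h.rel ▸ hAC, (ih hf hB).2 X σ K (hc h) a (hm hmem) w hw C hwC hwφ⟩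
  | box φ ih =>
    have hf : IsFormula φ := by cases hφ with | box a => exact a
    have ht : ∀ σ (K : Model (State L Sig)), Compat M B σ K ∅ (box φ) →
        subst σ (box φ) ∈ Sig → ∀ A : State L Sig, subst σ (box φ) ∈ A.1 →
        A ∈ meaning (box φ) K := by
      intro σ K h hmem A hA C hAC
      rw [h.rel] at hAC
      -- The instance of the box lies in `Sig`, so the upper bound on `R` applies.
      exact (ih hf hB).1 σ K (h.mono subset_rfl subset_rfl fun _ _ h => h)
        (hFL.subset (FLClosure.box (FLClosure.base hmem))) C (hM.le_rmax A C hAC _ hmem hA)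
    refine ⟨ht, fun X σ K h hcon hmem v hv A hA hvφ => ?_⟩
    cases hcon with | free _ hX => exact hfree _ ht hB X σ K h hX hmem v hv A hA hvφ
  | fix η y φ ih =>
    have hB' : BV φ ⊆ B := (Finset.subset_insert _ _).trans hB
    cases hφ with
    | mu hy =>
      have ihc := (ih hy.isFormula hB').2
      have ht : ∀ σ (K : Model (State L Sig)), Compat M B σ K ∅ (mu y φ) →
          subst σ (mu y φ) ∈ Sig → ∀ A : State L Sig, subst σ (mu y φ) ∈ A.1 →
          A ∈ meaning (mu y φ) K := by
        intro σ K h hmem A hA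
        obtain ⟨v, hv, hvA⟩ := A.exists_logicVal_descr hL hform hN0 hSig
        -- The first claim for `μ` is the second with `X = ∅`: a plain instance is a reading by
        -- descriptions in which nothing is described.
        rw [A.mem_iff_of_descr hL hform hneg hv.toBoolVal hvA hmem,
          ← h.subst_descrSubst hB hN (by simp)] at hA
        exact mem_meaning_mu hL hform hneg hFL hN0 hSig hN ihc h hB (by simpa using hy) hmem hv
          hvA hA
      refine ⟨ht, fun X σ K h hcon hmem v hv A hA hvφ => ?_⟩
      cases hcon with
      | free _ hX => exact hfree _ ht hB X σ K h hX hmem v hv A hA hvφ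
      | mu a => exact mem_meaning_mu hL hform hneg hFL hN0 hSig hN ihc h hB a hmem hv hA hvφ
    | nu hy =>
      have ht : ∀ σ (K : Model (State L Sig)), Compat M B σ K ∅ (nu y φ) →
          subst σ (nu y φ) ∈ Sig → ∀ A : State L Sig, subst σ (nu y φ) ∈ A.1 →
          A ∈ meaning (nu y φ) K := by
        intro σ K h hmem A hA
        rw [meaning, Set.mem_sUnion]
        -- The states containing the instance form the postfixpoint, and `y` is read as exactly this
        -- set.
        refine ⟨{C | subst σ (nu y φ) ∈ C.1}, fun C hC => ?_, hA⟩
        have hunf := h.unfold_mem hB hFL hmem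
        refine (ih hy.isFormula hB').1 _ _ (h.fix (hy.notMem_negLits rfl) (IsFormula.nu hy)
          (fun _ _ h => h) fun _ C hC => hC) hunf C ?_
        obtain ⟨v, hv, hvC⟩ := C.exists_logicVal hL hform
        have hf := hform _ hmem
        have hvθ := (hvC _ hmem).1 hC
        rw [hvC _ hunf, ← h.unfold hB]
        rw [h.subst_fix hB] at hf hvθ ⊢
        cases hf with | nu hco => exact hv.nu_unfold hL hco hvθ
      refine ⟨ht, fun X σ K h hcon hmem v hv A hA hvφ => ?_⟩
      cases hcon with | free _ hX => exact hfree _ ht hB X σ K h hX hmem v hv A hA hvφ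

end Truth

end MuC

theorem mainTheorem5 (L : Set MuC.Fml) (hL : MuC.IsMucLogic L)
    (Sig : Finset MuC.Fml) (hform : ∀ φ ∈ Sig, MuC.IsFormula φ)
    (hFL : MuC.FLClosed (Sig : Set MuC.Fml)) (hneg : MuC.NegClosed (Sig : Set MuC.Fml))
    (M : MuC.Model (MuC.State L Sig)) (hM : MuC.IsModelOver L Sig M)
    (A : MuC.State L Sig) (ξ : MuC.Fml) (hξ : ξ ∈ Sig) (hclean : ξ.Clean) :
    ξ ∈ A.1 → A ∈ MuC.meaning ξ M := by
  intro hA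
  obtain ⟨N, hN0, hSig⟩ := MuC.exists_varsBelow Sig
  -- The first claim is applied to the identity substitution and `M` itself, with the bound
  -- variables of `ξ` as the set to be avoided.
  refine (MuC.mem_meaning_of_compat hL hform hneg hFL hM hN0 hSig
    (fun u hu => hSig ξ hξ u (Finset.mem_union_right _ hu)) (hform ξ hξ) subset_rfl).1
    MuC.Fml.var M ⟨rfl, fun p _ _ C hC => ?_, fun p _ => ⟨rfl, rfl⟩, fun p hp u hu hup => ?_,
      fun p => MuC.IsFormula.var p⟩ (by simpa using hξ) A (by simpa using hA)
  · rw [hM.valuation p (C.subset hC)]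
    exact hC
  · rw [MuC.Fml.FV, Finset.mem_singleton] at hup
    subst hup
    -- Under the identity substitution, the freshness condition says that no variable of `ξ` is both
    -- free and bound.
    exact Finset.disjoint_left.1 hclean.1 hp hu
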